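/- Let $k$ be an algebraically closed field of characteristic $0$ and let $\mathcal C$ be a fusion category over $k$ (no unitarity or sphericity is assumed) with a pivotal structure, i.e. a monoidal natural isomorphism $\mathfrak a\colon \mathrm{Id}_{\mathcal C}\Rightarrow(-)^{RR}$. Here $w^L$ is the dual with $\mathrm{ev}\colon w^L\otimes w\to\mathbf 1$, $\mathrm{coev}\colon\mathbf 1\to w\otimes w^L$, and $w^R$ the dual with $\mathrm{ev}\colon w\otimes w^R\to\mathbf 1$, $\mathrm{coev}\colon\mathbf 1\to w^R\otimes w$; associators and unitors are suppressed. Let $\mathrm{Irr}(\mathcal C)$ be a complete set of pairwise non-isomorphic simple objects, in which the tensor unit is represented by an object identified with $\mathbf 1$. Let $\mathrm{Tube}_{\mathcal C}=\bigoplus_{x,y,w\in\mathrm{Irr}(\mathcal C)}\mathcal C(x\otimes w,w\otimes y)$ be the tube algebra: for $h\colon x'\otimes w'\to w'\otimes y'$ and $g\colon x\otimes w\to w\otimes y$, the product $h\cdot g$ is $0$ if $x\ne y'$, and otherwise its component in $\mathcal C(x'\otimes t,t\otimes y)$ is $$\sum_{\alpha=1}^{n_t}\bigl(x'\otimes t\xrightarrow{1\otimes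 I_t^\alpha}x'\otimes w'\otimes w\xrightarrow{h\otimes 1}w'\otimes y'\otimes w\xrightarrow{1\otimes g}w'\otimes w\otimes y\xrightarrow{P_t^\alpha\otimes 1}t\otimes y\bigr),$$ where $I_t^\alpha$, $P_t^\alpha$ are the inclusions and projections of a direct sum decomposition $w'\otimes w\cong\bigoplus_t t^{\oplus n_t}$; the unit is $\sum_x \mathrm{id}_x$ with $\mathrm{id}_x\in\mathcal C(x\otimes\mathbf 1,\mathbf 1\otimes x)$. Then there is a $k$-linear equivalence of categories from the Drinfeld center of $\mathcal C$ to the category of finite-dimensional left $\mathrm{Tube}_{\mathcal C}$-modules, $$J\colon\mathcal Z(\mathcal C)\to\mathrm{Rep}(\mathrm{Tube}_{\mathcal C}),\qquad (z,\gamma_{-,z})\mapsto\bigoplus_{x\in\mathrm{Irr}(\mathcal C)}\mathcal C(x,z),$$ which acts on morphisms by composition, where for $g\colon x\otimes w\to w\otimes y$ in $\mathrm{Tube}_{\mathcal C}$ and $s\colon x_0\to z$ with $x_0\in\mathrm{Irr}(\mathcal C)$, the element $g.s$ is $0$ if $x_0\neq y$, and otherwise is the composite $$x\xrightarrow{1\otimes\mathrm{coev}}x\otimes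 w\otimes w^L\xrightarrow{g\otimes1}w\otimes y\otimes w^L\xrightarrow{1\otimes s\otimes1}w\otimes z\otimes w^L\xrightarrow{\gamma_{w,z}\otimes1}z\otimes w\otimes w^L\xrightarrow{1\otimes\mathfrak a_{w^L}}z\otimes w\otimes w^R\xrightarrow{1\otimes\mathrm{ev}}z,$$ with $(w^L)^{RR}$ identified with $w^R$. -/

import Mathlib

open CategoryTheory CategoryTheory.Limits CategoryTheory.MonoidalCategory

universe w v u u'

set_option linter.unusedSectionVars false

noncomputable section

namespace TubeAlgebra

/-! ### Fusion categories -/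

section Fusion

attribute [local instance] Abelian.hasFiniteBiproducts

/-- A fusion category over a field `k`: an abelian `k`-linear rigid monoidal category with
`k`-bilinear tensor product, with finite-dimensional spaces of morphisms, in which every object is
a finite direct sum of simple objects, with finitely many simple objects up to isomorphism, and
whose tensor unit is simple. -/
class FusionCategory (k : Type u') [Field k] (C : Type u) [Category.{v} C] [Abelian C]
    [Linear k C] [MonoidalCategory C] [MonoidalPreadditive C] [MonoidalLinear k C]
    [RigidCategory C] : Prop where
  finiteDimensional_hom : ∀ X Y : C, FiniteDimensional k (X ⟶ Y)
  semisimple : ∀ X : C, ∃ (n : ℕ) (f : Fin n → C),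
    (∀ i, Simple (f i)) ∧ Nonempty (X ≅ ⨁ f)
  finite_simples : ∃ (n : ℕ) (f : Fin n → C),
    (∀ i, Simple (f i)) ∧ ∀ X : C, Simple X → ∃ i, Nonempty (X ≅ f i)
  simple_unit : Simple (𝟙_ C)

/-- A complete set `Irr(C)` of pairwise non-isomorphic simple objects of `C`, indexed by `ι`. -/
structure SimpleSystem (ι : Type w) (C : Type u) [Category.{v} C] [HasZeroMorphisms C] where
  /-- The simple object with a given index. -/
  obj : ι → C
  simple : ∀ i, Simple (obj i)
  eq_of_iso : ∀ i j, Nonempty (obj i ≅ obj j) → i = j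
  exists_iso : ∀ X : C, Simple X → ∃ i, Nonempty (X ≅ obj i)

end Fusion

/-! ### Duals and pivotal structures

The left dual `X^L` of an object comes with `X^L ⊗ X ⟶ 𝟙` and `𝟙 ⟶ X ⊗ X^L`; the right dual
`X^R` comes with `X ⊗ X^R ⟶ 𝟙` and `𝟙 ⟶ X^R ⊗ X`. (Mathlib uses the opposite words: its
`Xᘁ` is `X^L`, and its `ᘁX` is `X^R`.) -/

section Duals

variable {C : Type u} [Category.{v} C] [MonoidalCategory C] [RigidCategory C]

/-- The left dual `X^L`. -/
def lDual (X : C) : C := Xᘁ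

/-- The exact pairing of `X` with `X^L`. -/
instance lPairing (X : C) : ExactPairing X (lDual X) := inferInstanceAs (ExactPairing X Xᘁ)

/-- The coevaluation `𝟙 ⟶ X ⊗ X^L`. -/
def lCoev (X : C) : 𝟙_ C ⟶ X ⊗ lDual X := η_ X (lDual X)

/-- The right dual `X^R`. -/
def rDual (X : C) : C := ᘁX

/-- The exact pairing of `X^R` with `X`. -/
instance rPairing (X : C) : ExactPairing (rDual X) X := inferInstanceAs (ExactPairing (ᘁX) X)

/-- The evaluation `X ⊗ X^R ⟶ 𝟙`. -/
def rEv (X : C) : X ⊗ rDual X ⟶ 𝟙_ C := ε_ (rDual X) X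

/-- The right dual `f^R : Y^R ⟶ X^R` of a morphism `f : X ⟶ Y`. -/
def rDualMap {X Y : C} (f : X ⟶ Y) : rDual Y ⟶ rDual X := ᘁf

/-- Any object `Y` with an exact pairing exhibiting it as a right dual of `X` is canonically
isomorphic to `X^R`. -/
def rDualIso {X Y : C} (p : ExactPairing Y X) : rDual X ≅ Y := leftDualIso (rPairing X) p

lemma rDualMap_id (X : C) : rDualMap (𝟙 X) = 𝟙 (rDual X) := leftAdjointMate_id

lemma rDualMap_comp {X Y Z : C} (f : X ⟶ Y) (g : Y ⟶ Z) :
    rDualMap (f ≫ g) = rDualMap g ≫ rDualMap f := comp_leftAdjointMate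

variable (C) in
/-- The functor `X ↦ X^{RR}`. -/
def doubleDual : C ⥤ C where
  obj X := rDual (rDual X)
  map f := rDualMap (rDualMap f)
  map_id X := by rw [rDualMap_id, rDualMap_id]
  map_comp f g := by rw [rDualMap_comp, rDualMap_comp]

variable (C) in
/-- The canonical morphism `𝟙^{RR} ⟶ 𝟙`. -/
def doubleDualUnit : (doubleDual C).obj (𝟙_ C) ⟶ 𝟙_ C :=
  rDualMap (rDualIso (exactPairingUnit (C := C))).inv ≫ (rDualIso (exactPairingUnit (C := C))).hom

/-- The canonical morphism `(X ⊗ Y)^{RR} ⟶ X^{RR} ⊗ Y^{RR}`, obtained by applying twice the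
canonical isomorphism `(X ⊗ Y)^R ≅ Y^R ⊗ X^R`. -/
def doubleDualTensor (X Y : C) :
    (doubleDual C).obj (X ⊗ Y) ⟶ (doubleDual C).obj X ⊗ (doubleDual C).obj Y :=
  rDualMap (rDualIso (ExactPairing.tensor (X₁ := rDual Y) (Y₁ := Y) (X₂ := rDual X)
    (Y₂ := X))).inv ≫
  (rDualIso (ExactPairing.tensor (X₁ := rDual (rDual X)) (Y₁ := rDual X)
    (X₂ := rDual (rDual Y)) (Y₂ := rDual Y))).hom

variable (C) in
/-- A pivotal structure: a monoidal natural isomorphism from the identity functor to the functor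
`X ↦ X^{RR}`. -/
structure PivotalStructure where
  /-- The underlying natural isomorphism. -/
  iso : 𝟭 C ≅ doubleDual C
  unit : iso.hom.app (𝟙_ C) ≫ doubleDualUnit C = 𝟙 (𝟙_ C)
  tensor : ∀ X Y : C, iso.hom.app (X ⊗ Y) ≫ doubleDualTensor X Y =
    (iso.hom.app X ⊗ₘ iso.hom.app Y)

/-- The isomorphism `𝔞_{X^L} : X^L ⟶ (X^L)^{RR} ≅ X^R`, where the last identification is induced
by the canonical isomorphism `(X^L)^R ≅ X`. -/
def PivotalStructure.appL (a : PivotalStructure C) (X : C) : lDual X ⟶ rDual X :=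
  a.iso.hom.app (lDual X) ≫ rDualMap (rDualIso (lPairing X)).inv

end Duals

/-! ### The `k`-linear structure of the Drinfeld center -/

section Center

lemma center_hom_injective {C : Type u} [Category.{v} C] [MonoidalCategory C] (X Y : Center C) :
    Function.Injective (fun f : X ⟶ Y => f.f) := fun f g h => Center.ext f g h

variable {C : Type u} [Category.{v} C] [Preadditive C] [MonoidalCategory C]
  [MonoidalPreadditive C]

lemma comm_zero {A B U : C} (p : A ⊗ U ⟶ U ⊗ A) (q : B ⊗ U ⟶ U ⊗ B) :
    (0 : A ⟶ B) ▷ U ≫ q = p ≫ U ◁ (0 : A ⟶ B) := by simp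

lemma comm_add {A B U : C} {p : A ⊗ U ⟶ U ⊗ A} {q : B ⊗ U ⟶ U ⊗ B} {f g : A ⟶ B}
    (hf : f ▷ U ≫ q = p ≫ U ◁ f) (hg : g ▷ U ≫ q = p ≫ U ◁ g) :
    (f + g) ▷ U ≫ q = p ≫ U ◁ (f + g) := by
  simp [hf, hg]

lemma comm_neg {A B U : C} {p : A ⊗ U ⟶ U ⊗ A} {q : B ⊗ U ⟶ U ⊗ B} {f : A ⟶ B}
    (hf : f ▷ U ≫ q = p ≫ U ◁ f) : (-f) ▷ U ≫ q = p ≫ U ◁ (-f) := by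
  have h₁ : (-f) ▷ U = -(f ▷ U) := (tensorRight U).map_neg
  have h₂ : U ◁ (-f) = -(U ◁ f) := (tensorLeft U).map_neg
  simp [h₁, h₂, hf]

instance (X Y : Center C) : Zero (X ⟶ Y) := ⟨⟨0, fun _ => comm_zero _ _⟩⟩

instance (X Y : Center C) : Add (X ⟶ Y) :=
  ⟨fun f g => ⟨f.f + g.f, fun U => comm_add (f.comm U) (g.comm U)⟩⟩

instance (X Y : Center C) : Neg (X ⟶ Y) := ⟨fun f => ⟨-f.f, fun U => comm_neg (f.comm U)⟩⟩

instance (X Y : Center C) : AddCommGroup (X ⟶ Y) where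
  add_assoc f g h := Center.ext _ _ (add_assoc f.f g.f h.f)
  zero_add f := Center.ext _ _ (zero_add f.f)
  add_zero f := Center.ext _ _ (add_zero f.f)
  nsmul := nsmulRec
  zsmul := zsmulRec
  neg_add_cancel f := Center.ext _ _ (neg_add_cancel f.f)
  add_comm f g := Center.ext _ _ (add_comm f.f g.f)

instance centerPreadditive : Preadditive (Center C) where
  add_comp _ _ _ f f' g := Center.ext _ _ (Preadditive.add_comp _ _ _ f.f f'.f g.f)
  comp_add _ _ _ f g g' := Center.ext _ _ (Preadditive.comp_add _ _ _ f.f g.f g'.f)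

lemma comm_smul {k : Type u'} [Field k] [Linear k C] [MonoidalLinear k C] {A B U : C}
    {p : A ⊗ U ⟶ U ⊗ A} {q : B ⊗ U ⟶ U ⊗ B} {f : A ⟶ B} (r : k)
    (hf : f ▷ U ≫ q = p ≫ U ◁ f) : (r • f) ▷ U ≫ q = p ≫ U ◁ (r • f) := by
  simp [hf]

variable {k : Type u'} [Field k] [Linear k C] [MonoidalLinear k C]

instance (X Y : Center C) : SMul k (X ⟶ Y) := ⟨fun r f => ⟨r • f.f, fun U => comm_smul r (f.comm U)⟩⟩

/-- Forgetting the half-braidings, as an additive map on morphisms. -/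
def centerForgetHom (X Y : Center C) : (X ⟶ Y) →+ (X.1 ⟶ Y.1) where
  toFun f := f.f
  map_zero' := rfl
  map_add' _ _ := rfl

instance (X Y : Center C) : Module k (X ⟶ Y) :=
  (center_hom_injective X Y).module k (centerForgetHom X Y) (fun _ _ => rfl)

instance centerLinear : Linear k (Center C) where
  smul_comp _ _ _ r f g := Center.ext _ _ (Linear.smul_comp _ _ _ r f.f g.f)
  comp_smul _ _ _ f r g := Center.ext _ _ (Linear.comp_smul _ _ _ f.f r g.f)

end Center

/-! ### Decompositions into simple objects -/

section Decomposition

variable {ι : Type w} [Fintype ι] {C : Type u} [Category.{v} C] [Preadditive C]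

/-- A direct sum decomposition `X ≅ ⨁_t t^{⊕ n_t}` of an object, where `t` runs through a complete
set of simple objects, given by its inclusions and projections. -/
structure Decomposition (S : SimpleSystem ι C) (X : C) where
  /-- The multiplicity `n_t`. -/
  mult : ι → ℕ
  /-- The inclusions `I_t^α : t ⟶ X`. -/
  incl : ∀ t, Fin (mult t) → (S.obj t ⟶ X)
  /-- The projections `P_t^α : X ⟶ t`. -/
  proj : ∀ t, Fin (mult t) → (X ⟶ S.obj t)
  incl_proj_self : ∀ t a, incl t a ≫ proj t a = 𝟙 _
  incl_proj_of_ne : ∀ t a b, a ≠ b → incl t a ≫ proj t b = 0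
  incl_proj_of_ne_index : ∀ t s a b, t ≠ s → incl t a ≫ proj s b = 0
  sum_proj_incl : ∑ t, ∑ a, proj t a ≫ incl t a = 𝟙 X

end Decomposition

/-- A morphism between simple objects of a complete set is zero if their indices differ. -/
lemma hom_eq_zero_of_ne {ι : Type w} {C : Type u} [Category.{v} C] [Abelian C]
    (S : SimpleSystem ι C) {i j : ι} (h : i ≠ j) (f : S.obj i ⟶ S.obj j) : f = 0 := by
  by_contra hf
  have := S.simple i
  have := S.simple j
  have := isIso_of_hom_simple hf
  exact h (S.eq_of_iso i j ⟨asIso f⟩)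

section

attribute [local instance] Abelian.hasFiniteBiproducts

theorem nonempty_decomposition (k : Type u') [Field k] {ι : Type w} [Fintype ι] {C : Type u}
    [Category.{v} C] [Abelian C] [Linear k C] [MonoidalCategory C] [MonoidalPreadditive C]
    [MonoidalLinear k C] [RigidCategory C] [FusionCategory k C] (S : SimpleSystem ι C) (X : C) :
    Nonempty (Decomposition S X) := by
  classical
  obtain ⟨n, f, hf, ⟨e⟩⟩ := FusionCategory.semisimple k X
  choose c hc using fun j => S.exists_iso (f j) (hf j)
  let u : ∀ j, f j ≅ S.obj (c j) := fun j => (hc j).some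
  let In : ∀ t, {j // c j = t} → (S.obj t ⟶ X) := fun t j =>
    eqToHom (by rw [j.2]) ≫ (u j).inv ≫ biproduct.ι f j ≫ e.inv
  let Pr : ∀ t, {j // c j = t} → (X ⟶ S.obj t) := fun t j =>
    e.hom ≫ biproduct.π f j ≫ (u j).hom ≫ eqToHom (by rw [j.2])
  let σ : ∀ t, Fin (Fintype.card {j // c j = t}) ≃ {j // c j = t} := fun t =>
    (Fintype.equivFin _).symm
  have hne : ∀ t (a b : {j // c j = t}), a ≠ b → In t a ≫ Pr t b = 0 := by
    intro t a b hab
    have : biproduct.ι f a.1 ≫ biproduct.π f b.1 = 0 :=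
      biproduct.ι_π_ne f (fun h => hab (Subtype.ext h))
    simp [In, Pr, reassoc_of% this]
  refine ⟨⟨fun t => Fintype.card {j // c j = t}, fun t a => In t (σ t a),
    fun t a => Pr t (σ t a), ?_, ?_, ?_, ?_⟩⟩
  · intro t a
    simp [In, Pr]
  · intro t a b hab
    exact hne t _ _ (fun h => hab ((σ t).injective h))
  · intro t s a b h
    exact hom_eq_zero_of_ne S h _
  · have h1 : ∀ t, ∑ a, Pr t (σ t a) ≫ In t (σ t a) =
        ∑ j : {j // c j = t}, e.hom ≫ biproduct.π f j.1 ≫ biproduct.ι f j.1 ≫ e.inv := by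
      intro t
      rw [← (σ t).sum_comp (fun j => e.hom ≫ biproduct.π f j.1 ≫ biproduct.ι f j.1 ≫ e.inv)]
      refine Finset.sum_congr rfl fun a _ => ?_
      simp [In, Pr]
    simp only [h1]
    rw [← Fintype.sum_sigma' (fun t (j : {j // c j = t}) =>
      e.hom ≫ biproduct.π f j.1 ≫ biproduct.ι f j.1 ≫ e.inv)]
    refine ((Equiv.sigmaFiberEquiv c).sum_comp
      (fun j => e.hom ≫ biproduct.π f j ≫ biproduct.ι f j ≫ e.inv)).trans ?_
    have h2 : ∑ j, e.hom ≫ biproduct.π f j ≫ biproduct.ι f j ≫ e.inv =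
        e.hom ≫ (∑ j, biproduct.π f j ≫ biproduct.ι f j) ≫ e.inv := by
      rw [Preadditive.sum_comp, Preadditive.comp_sum]
      simp only [Category.assoc]
    rw [h2, biproduct.total]
    simp

end

/-! ### The tube algebra -/

section Tube

variable {C : Type u} [Category.{v} C] [MonoidalCategory C]

/-- The composite `A ⊗ (X ⊗ Y) ⟶ (X ⊗ B) ⊗ Y ⟶ (X ⊗ Y) ⊗ D` of `h ⊗ 1` and `1 ⊗ g`
(up to associators), for `h : A ⊗ X ⟶ X ⊗ B` and `g : B ⊗ Y ⟶ Y ⊗ D`. -/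
def stack {A B D X Y : C} (h : A ⊗ X ⟶ X ⊗ B) (g : B ⊗ Y ⟶ Y ⊗ D) :
    A ⊗ (X ⊗ Y) ⟶ (X ⊗ Y) ⊗ D :=
  (α_ A X Y).inv ≫ h ▷ Y ≫ (α_ X B Y).hom ≫ X ◁ g ≫ (α_ X Y D).inv

/-- The composite `A ⊗ T ⟶ A ⊗ X ⟶ X ⊗ B ⟶ T ⊗ B` of `1 ⊗ I`, `f` and `P ⊗ 1`. -/
def conj {A B T X : C} (I : T ⟶ X) (P : X ⟶ T) (f : A ⊗ X ⟶ X ⊗ B) : A ⊗ T ⟶ T ⊗ B :=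
  A ◁ I ≫ f ≫ P ▷ B

lemma conj_conj {A B T X Z : C} (I : T ⟶ X) (P : X ⟶ T) (J : X ⟶ Z) (Q : Z ⟶ X)
    (f : A ⊗ Z ⟶ Z ⊗ B) : conj I P (conj J Q f) = conj (I ≫ J) (Q ≫ P) f := by
  simp [conj]

lemma stack_conj_left {A B D T X Y : C} (I : T ⟶ X) (P : X ⟶ T) (h : A ⊗ X ⟶ X ⊗ B)
    (g : B ⊗ Y ⟶ Y ⊗ D) : stack (conj I P h) g = conj (I ▷ Y) (P ▷ Y) (stack h g) := by
  simp only [conj, stack, comp_whiskerRight, Category.assoc]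
  rw [associator_naturality_left_assoc, ← whisker_exchange_assoc]
  simp

lemma stack_conj_right {A B D T X Y : C} (I : T ⟶ Y) (P : Y ⟶ T) (h : A ⊗ X ⟶ X ⊗ B)
    (g : B ⊗ Y ⟶ Y ⊗ D) : stack h (conj I P g) = conj (X ◁ I) (X ◁ P) (stack h g) := by
  simp only [conj, stack, whiskerLeft_comp, Category.assoc]
  rw [← associator_naturality_right_assoc, ← whisker_exchange_assoc]
  simp

lemma stack_assoc {A B D E X Y Z : C} (f : A ⊗ X ⟶ X ⊗ B) (g : B ⊗ Y ⟶ Y ⊗ D)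
    (h : D ⊗ Z ⟶ Z ⊗ E) :
    stack (stack f g) h = conj (α_ X Y Z).hom (α_ X Y Z).inv (stack f (stack g h)) := by
  simp only [conj, stack]
  monoidal

end Tube

section Additive

variable {C : Type u} [Category.{v} C] [Preadditive C] [MonoidalCategory C]
  [MonoidalPreadditive C]

lemma conj_add {A B T X : C} (I : T ⟶ X) (P : X ⟶ T) (f g : A ⊗ X ⟶ X ⊗ B) :
    conj I P (f + g) = conj I P f + conj I P g := by
  simp [conj]

lemma conj_sum_left {A B T X : C} {κ : Type*} (s : Finset κ) (I : κ → (T ⟶ X)) (P : X ⟶ T)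
    (f : A ⊗ X ⟶ X ⊗ B) : conj (∑ a ∈ s, I a) P f = ∑ a ∈ s, conj (I a) P f := by
  simp [conj, whiskerLeft_sum, Preadditive.sum_comp]

lemma conj_sum_right {A B T X : C} {κ : Type*} (s : Finset κ) (I : T ⟶ X) (P : κ → (X ⟶ T))
    (f : A ⊗ X ⟶ X ⊗ B) : conj I (∑ a ∈ s, P a) f = ∑ a ∈ s, conj I (P a) f := by
  simp [conj, sum_whiskerRight, Preadditive.comp_sum]

lemma conj_zero_left {A B T X : C} (P : X ⟶ T) (f : A ⊗ X ⟶ X ⊗ B) : conj 0 P f = 0 := by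
  simp [conj]

lemma stack_add_left {A B D X Y : C} (h h' : A ⊗ X ⟶ X ⊗ B) (g : B ⊗ Y ⟶ Y ⊗ D) :
    stack (h + h') g = stack h g + stack h' g := by
  simp [stack]

lemma stack_add_right {A B D X Y : C} (h : A ⊗ X ⟶ X ⊗ B) (g g' : B ⊗ Y ⟶ Y ⊗ D) :
    stack h (g + g') = stack h g + stack h g' := by
  simp [stack]

variable {k : Type u'} [Field k] [Linear k C] [MonoidalLinear k C]

lemma conj_smul {A B T X : C} (I : T ⟶ X) (P : X ⟶ T) (r : k) (f : A ⊗ X ⟶ X ⊗ B) :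
    conj I P (r • f) = r • conj I P f := by
  simp [conj]

lemma conj_smul_left {A B T X : C} (I : T ⟶ X) (P : X ⟶ T) (r : k) (f : A ⊗ X ⟶ X ⊗ B) :
    conj (r • I) P f = r • conj I P f := by
  simp [conj]

lemma conj_smul_right {A B T X : C} (I : T ⟶ X) (P : X ⟶ T) (r : k) (f : A ⊗ X ⟶ X ⊗ B) :
    conj I (r • P) f = r • conj I P f := by
  simp [conj]

lemma stack_smul_left {A B D X Y : C} (r : k) (h : A ⊗ X ⟶ X ⊗ B) (g : B ⊗ Y ⟶ Y ⊗ D) :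
    stack (r • h) g = r • stack h g := by
  simp [stack]

lemma stack_smul_right {A B D X Y : C} (r : k) (h : A ⊗ X ⟶ X ⊗ B) (g : B ⊗ Y ⟶ Y ⊗ D) :
    stack h (r • g) = r • stack h g := by
  simp [stack]

end Additive

section Fusion

variable (k : Type u') [Field k] [IsAlgClosed k] {ι : Type w} [Fintype ι] {C : Type u}
  [Category.{v} C] [Abelian C] [Linear k C] [MonoidalCategory C] [MonoidalPreadditive C]
  [MonoidalLinear k C] [RigidCategory C] [FusionCategory k C] (S : SimpleSystem ι C)

lemma exists_smul_id (i : ι) (f : S.obj i ⟶ S.obj i) : ∃ c : k, c • 𝟙 (S.obj i) = f := by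
  have := S.simple i
  have := FusionCategory.finiteDimensional_hom (k := k) (S.obj i) (S.obj i)
  exact endomorphism_simple_eq_smul_id k f

/-- The sum `∑ (I_a ; f ; P_a)` over the inclusions and projections of the summands `t` of `X`
does not depend on the chosen decomposition of `X`. -/
lemma sum_conj_eq (k : Type u') [Field k] [IsAlgClosed k] {ι : Type w} [Fintype ι] {C : Type u}
    [Category.{v} C] [Abelian C] [Linear k C] [MonoidalCategory C] [MonoidalPreadditive C]
    [MonoidalLinear k C] [RigidCategory C] [FusionCategory k C] (S : SimpleSystem ι C)
    {A B X : C} (f : A ⊗ X ⟶ X ⊗ B) {κ : ι → Type*} {κ' : ι → Type*}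
    [∀ t, Fintype (κ t)] [∀ t, Fintype (κ' t)]
    (I : ∀ t, κ t → (S.obj t ⟶ X)) (P : ∀ t, κ t → (X ⟶ S.obj t))
    (I' : ∀ t, κ' t → (S.obj t ⟶ X)) (P' : ∀ t, κ' t → (X ⟶ S.obj t))
    (h : ∑ t, ∑ a, P t a ≫ I t a = 𝟙 X) (h' : ∑ t, ∑ a, P' t a ≫ I' t a = 𝟙 X) (t : ι) :
    ∑ a, conj (I t a) (P t a) f = ∑ a, conj (I' t a) (P' t a) f := by
  choose c hc using fun (b : κ' t) (a : κ t) => exists_smul_id k S t (I' t b ≫ P t a)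
  have hI : ∀ b, I' t b = ∑ a, c b a • I t a := by
    intro b
    rw [← Category.comp_id (I' t b), ← h, Preadditive.comp_sum, Finset.sum_eq_single t]
    · rw [Preadditive.comp_sum]
      refine Finset.sum_congr rfl fun a _ => ?_
      rw [← Category.assoc, ← hc b a]
      simp
    · intro s _ hs
      rw [Preadditive.comp_sum]
      refine Finset.sum_eq_zero fun a _ => ?_
      rw [← Category.assoc, hom_eq_zero_of_ne S (Ne.symm hs) (I' t b ≫ P s a), zero_comp]
    · simp
  have hP : ∀ a, P t a = ∑ b, c b a • P' t b := by
    intro a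
    rw [← Category.id_comp (P t a), ← h', Preadditive.sum_comp, Finset.sum_eq_single t]
    · rw [Preadditive.sum_comp]
      refine Finset.sum_congr rfl fun b _ => ?_
      rw [Category.assoc, ← hc b a]
      simp
    · intro s _ hs
      rw [Preadditive.sum_comp]
      refine Finset.sum_eq_zero fun b _ => ?_
      rw [Category.assoc, hom_eq_zero_of_ne S hs (I' s b ≫ P t a), comp_zero]
    · simp
  calc ∑ a, conj (I t a) (P t a) f = ∑ a, ∑ b, c b a • conj (I t a) (P' t b) f := by
        refine Finset.sum_congr rfl fun a _ => ?_
        rw [hP a, conj_sum_right]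
        simp only [conj_smul_right]
    _ = ∑ b, ∑ a, c b a • conj (I t a) (P' t b) f := Finset.sum_comm
    _ = ∑ b, conj (I' t b) (P' t b) f := by
        refine Finset.sum_congr rfl fun b _ => ?_
        rw [hI b, conj_sum_left]
        simp only [conj_smul_left]

/-- A chosen decomposition of an object into simple objects. -/
def decomp (X : C) : Decomposition S X := (nonempty_decomposition k S X).some

/-- The sum over `α` of the composites of `1 ⊗ I_t^α`, `f` and `P_t^α ⊗ 1`. -/
def component {A B X : C} (f : A ⊗ X ⟶ X ⊗ B) (t : ι) : A ⊗ S.obj t ⟶ S.obj t ⊗ B :=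
  ∑ a, conj ((decomp k S X).incl t a) ((decomp k S X).proj t a) f

/-- `component` may be computed with any decomposition. -/
lemma component_eq {A B X : C} (f : A ⊗ X ⟶ X ⊗ B) {κ : ι → Type*} [∀ t, Fintype (κ t)]
    (I : ∀ t, κ t → (S.obj t ⟶ X)) (P : ∀ t, κ t → (X ⟶ S.obj t))
    (h : ∑ t, ∑ a, P t a ≫ I t a = 𝟙 X) (t : ι) :
    component k S f t = ∑ a, conj (I t a) (P t a) f :=
  sum_conj_eq k S f _ _ I P (decomp k S X).sum_proj_incl h t

lemma component_add {A B X : C} (f g : A ⊗ X ⟶ X ⊗ B) (t : ι) :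
    component k S (f + g) t = component k S f t + component k S g t := by
  simp [component, conj_add, Finset.sum_add_distrib]

/-- `component` as an additive map. -/
def componentHom (A B X : C) (t : ι) :
    (A ⊗ X ⟶ X ⊗ B) →+ (A ⊗ S.obj t ⟶ S.obj t ⊗ B) :=
  AddMonoidHom.mk' (fun f => component k S f t) fun f g => component_add k S f g t

lemma component_zero {A B X : C} (t : ι) :
    component k S (0 : A ⊗ X ⟶ X ⊗ B) t = 0 :=
  (componentHom k S A B X t).map_zero

lemma component_sum {A B X : C} {κ : Type*} (s : Finset κ) (f : κ → (A ⊗ X ⟶ X ⊗ B)) (t : ι) :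
    component k S (∑ a ∈ s, f a) t = ∑ a ∈ s, component k S (f a) t :=
  map_sum (componentHom k S A B X t) f s

lemma component_smul {A B X : C} (r : k) (f : A ⊗ X ⟶ X ⊗ B) (t : ι) :
    component k S (r • f) t = r • component k S f t := by
  simp [component, conj_smul, Finset.smul_sum]

lemma component_conj_iso {A B X Z : C} (e : X ≅ Z) (f : A ⊗ Z ⟶ Z ⊗ B) (t : ι) :
    component k S (conj e.hom e.inv f) t = component k S f t := by
  rw [component_eq k S f (fun t a => (decomp k S X).incl t a ≫ e.hom)
    (fun t a => e.inv ≫ (decomp k S X).proj t a)]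
  · simp [component, conj_conj]
  · have : ∑ t, ∑ a, (e.inv ≫ (decomp k S X).proj t a) ≫ (decomp k S X).incl t a ≫ e.hom =
        e.inv ≫ (∑ t, ∑ a, (decomp k S X).proj t a ≫ (decomp k S X).incl t a) ≫ e.hom := by
      simp [Preadditive.sum_comp, Preadditive.comp_sum]
    rw [this, (decomp k S X).sum_proj_incl]
    simp

lemma stack_component_left {A B D X Y : C} (h : A ⊗ X ⟶ X ⊗ B) (g : B ⊗ Y ⟶ Y ⊗ D) (t : ι) :
    ∑ s, component k S (stack (component k S h s) g) t = component k S (stack h g) t := by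
  rw [component_eq k S (stack h g)
    (κ := fun t => Σ s, Fin ((decomp k S X).mult s) × Fin ((decomp k S (S.obj s ⊗ Y)).mult t))
    (fun t a => (decomp k S (S.obj a.1 ⊗ Y)).incl t a.2.2 ≫ (decomp k S X).incl a.1 a.2.1 ▷ Y)
    (fun t a => (decomp k S X).proj a.1 a.2.1 ▷ Y ≫ (decomp k S (S.obj a.1 ⊗ Y)).proj t a.2.2)]
  · rw [Fintype.sum_sigma]
    refine Finset.sum_congr rfl fun s _ => ?_
    rw [Fintype.sum_prod_type]
    simp only [← conj_conj, ← stack_conj_left]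
    change _ = ∑ a, component k S _ t
    rw [← component_sum]
    congr 1
    exact map_sum (AddMonoidHom.mk' (fun h => stack h g) fun _ _ => stack_add_left _ _ _) _ _
  · have h1 : ∀ s (a : Fin ((decomp k S X).mult s)),
        (decomp k S X).proj s a ▷ Y ≫ (decomp k S X).incl s a ▷ Y =
        ∑ t, ∑ b, ((decomp k S X).proj s a ▷ Y ≫ (decomp k S (S.obj s ⊗ Y)).proj t b) ≫
          (decomp k S (S.obj s ⊗ Y)).incl t b ≫ (decomp k S X).incl s a ▷ Y := by
      intro s a
      conv_lhs => rw [← Category.id_comp ((decomp k S X).incl s a ▷ Y),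
        ← (decomp k S (S.obj s ⊗ Y)).sum_proj_incl]
      simp [Preadditive.sum_comp, Preadditive.comp_sum]
    have h2 : ∑ s, ∑ a, (decomp k S X).proj s a ▷ Y ≫ (decomp k S X).incl s a ▷ Y =
        𝟙 (X ⊗ Y) := by
      simp only [← comp_whiskerRight, ← sum_whiskerRight, (decomp k S X).sum_proj_incl]
      simp
    rw [← h2]
    simp only [h1, Fintype.sum_sigma, Fintype.sum_prod_type]
    rw [Finset.sum_comm]
    exact Finset.sum_congr rfl fun s _ => Finset.sum_comm

lemma stack_component_right {A B D X Y : C} (h : A ⊗ X ⟶ X ⊗ B) (g : B ⊗ Y ⟶ Y ⊗ D) (t : ι) :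
    ∑ s, component k S (stack h (component k S g s)) t = component k S (stack h g) t := by
  rw [component_eq k S (stack h g)
    (κ := fun t => Σ s, Fin ((decomp k S Y).mult s) × Fin ((decomp k S (X ⊗ S.obj s)).mult t))
    (fun t a => (decomp k S (X ⊗ S.obj a.1)).incl t a.2.2 ≫ X ◁ (decomp k S Y).incl a.1 a.2.1)
    (fun t a => X ◁ (decomp k S Y).proj a.1 a.2.1 ≫ (decomp k S (X ⊗ S.obj a.1)).proj t a.2.2)]
  · rw [Fintype.sum_sigma]
    refine Finset.sum_congr rfl fun s _ => ?_
    rw [Fintype.sum_prod_type]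
    simp only [← conj_conj, ← stack_conj_right]
    change _ = ∑ a, component k S _ t
    rw [← component_sum]
    congr 1
    exact map_sum (AddMonoidHom.mk' (fun g => stack h g) fun _ _ => stack_add_right _ _ _) _ _
  · have h1 : ∀ s (a : Fin ((decomp k S Y).mult s)),
        X ◁ (decomp k S Y).proj s a ≫ X ◁ (decomp k S Y).incl s a =
        ∑ t, ∑ b, (X ◁ (decomp k S Y).proj s a ≫ (decomp k S (X ⊗ S.obj s)).proj t b) ≫
          (decomp k S (X ⊗ S.obj s)).incl t b ≫ X ◁ (decomp k S Y).incl s a := by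
      intro s a
      conv_lhs => rw [← Category.id_comp (X ◁ (decomp k S Y).incl s a),
        ← (decomp k S (X ⊗ S.obj s)).sum_proj_incl]
      simp [Preadditive.sum_comp, Preadditive.comp_sum]
    have h2 : ∑ s, ∑ a, X ◁ (decomp k S Y).proj s a ≫ X ◁ (decomp k S Y).incl s a =
        𝟙 (X ⊗ Y) := by
      simp only [← whiskerLeft_comp, ← whiskerLeft_sum, (decomp k S Y).sum_proj_incl]
      simp
    rw [← h2]
    simp only [h1, Fintype.sum_sigma, Fintype.sum_prod_type]
    rw [Finset.sum_comm]
    exact Finset.sum_congr rfl fun s _ => Finset.sum_comm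

lemma component_obj_self {A B : C} {t : ι} (f : A ⊗ S.obj t ⟶ S.obj t ⊗ B) :
    component k S f t = f := by
  have h : ∑ a, (decomp k S (S.obj t)).proj t a ≫ (decomp k S (S.obj t)).incl t a =
      𝟙 (S.obj t) := by
    conv_rhs => rw [← (decomp k S (S.obj t)).sum_proj_incl]
    symm
    refine Finset.sum_eq_single t (fun s _ hs => Finset.sum_eq_zero fun a _ => ?_) (by simp)
    rw [hom_eq_zero_of_ne S hs ((decomp k S (S.obj t)).incl s a), comp_zero]
  have h1 : ∀ a, conj ((decomp k S (S.obj t)).incl t a) ((decomp k S (S.obj t)).proj t a) f =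
      f ≫ ((decomp k S (S.obj t)).proj t a ≫ (decomp k S (S.obj t)).incl t a) ▷ B := by
    intro a
    obtain ⟨c, hc⟩ := exists_smul_id k S t ((decomp k S (S.obj t)).incl t a)
    rw [← hc]
    simp [conj]
  simp only [component, h1]
  rw [← Preadditive.comp_sum, ← sum_whiskerRight, h]
  simp

lemma component_obj_of_ne {A B : C} {i t : ι} (hi : i ≠ t) (f : A ⊗ S.obj i ⟶ S.obj i ⊗ B) :
    component k S f t = 0 := by
  refine Finset.sum_eq_zero fun a _ => ?_
  rw [hom_eq_zero_of_ne S hi.symm ((decomp k S (S.obj i)).incl t a), conj_zero_left]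

/-- The underlying vector space `⨁_{w,x,y} C(x ⊗ w, w ⊗ y)` of the tube algebra; the component of
`g` at `(w, x, y)` is `g w x y`. -/
def Tube (_k : Type u') {ι : Type w} {C : Type u} [Category.{v} C] [Abelian C]
    [MonoidalCategory C] (S : SimpleSystem ι C) : Type (max w v) :=
  ∀ w x y : ι, S.obj x ⊗ S.obj w ⟶ S.obj w ⊗ S.obj y

namespace Tube

instance : AddCommGroup (Tube k S) :=
  inferInstanceAs (AddCommGroup (∀ w x y : ι, S.obj x ⊗ S.obj w ⟶ S.obj w ⊗ S.obj y))

instance : Module k (Tube k S) :=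
  inferInstanceAs (Module k (∀ w x y : ι, S.obj x ⊗ S.obj w ⟶ S.obj w ⊗ S.obj y))

variable {k S}

@[ext] lemma ext {f g : Tube k S} (h : ∀ w x y, f w x y = g w x y) : f = g :=
  funext fun w => funext fun x => funext fun y => h w x y

@[simp] lemma zero_apply (w x y : ι) : (0 : Tube k S) w x y = 0 := rfl

@[simp] lemma add_apply (f g : Tube k S) (w x y : ι) : (f + g) w x y = f w x y + g w x y := rfl

@[simp] lemma smul_apply (r : k) (g : Tube k S) (w x y : ι) : (r • g) w x y = r • g w x y := rfl

variable (k S)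

open Classical in
/-- The inclusion of the summand `C(x ⊗ w, w ⊗ y)`. -/
def single (w x y : ι) (f : S.obj x ⊗ S.obj w ⟶ S.obj w ⊗ S.obj y) : Tube k S :=
  Pi.single w (Pi.single x (Pi.single y f))

/-- The index of the simple object isomorphic to the tensor unit. -/
def unitIndex : ι := (S.exists_iso (𝟙_ C) (FusionCategory.simple_unit k)).choose

/-- The identification of a member of the chosen set of simple objects with the tensor unit. -/
def unitIso : S.obj (unitIndex k S) ≅ 𝟙_ C :=
  (S.exists_iso (𝟙_ C) (FusionCategory.simple_unit k)).choose_spec.some.symm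

/-- The morphism `id_x`, seen as a morphism `x ⊗ 𝟙 ⟶ 𝟙 ⊗ x`. -/
def unitHom (x : ι) :
    S.obj x ⊗ S.obj (unitIndex k S) ⟶ S.obj (unitIndex k S) ⊗ S.obj x :=
  S.obj x ◁ (unitIso k S).hom ≫ (ρ_ _).hom ≫ (λ_ _).inv ≫ (unitIso k S).inv ▷ S.obj x

/-- The unit of the tube algebra: the sum of all `id_x : x ⊗ 𝟙 ⟶ 𝟙 ⊗ x`. -/
instance : One (Tube k S) := ⟨∑ x, single k S (unitIndex k S) x x (unitHom k S x)⟩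

/-- The multiplication of the tube algebra: for `h ∈ C(x' ⊗ w', w' ⊗ y')` and
`g ∈ C(x ⊗ w, w ⊗ y)` with `x = y'`, the component of `h * g` at `t` is the sum over `α` of
`x' ⊗ t ⟶ x' ⊗ (w' ⊗ w) ⟶ (w' ⊗ y') ⊗ w = w' ⊗ (x ⊗ w) ⟶ (w' ⊗ w) ⊗ y ⟶ t ⊗ y`,
with outer maps given by the inclusions and projections of the summands `t` of `w' ⊗ w`. -/
instance : Mul (Tube k S) :=
  ⟨fun h g t x y => ∑ w', ∑ w, ∑ m, component k S (stack (h w' x m) (g w m y)) t⟩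

variable {k S}

lemma mul_apply (h g : Tube k S) (t x y : ι) :
    (h * g) t x y = ∑ w', ∑ w, ∑ m, component k S (stack (h w' x m) (g w m y)) t := rfl

/-- The multiplication, computed with arbitrary decompositions of the objects `w' ⊗ w`. -/
lemma mul_apply_eq (D : ∀ w' w : ι, Decomposition S (S.obj w' ⊗ S.obj w)) (h g : Tube k S)
    (t x y : ι) : (h * g) t x y = ∑ w', ∑ w, ∑ m, ∑ a,
      S.obj x ◁ (D w' w).incl t a ≫ stack (h w' x m) (g w m y) ≫
        (D w' w).proj t a ▷ S.obj y := by
  rw [mul_apply]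
  refine Finset.sum_congr rfl fun w' _ => Finset.sum_congr rfl fun w _ =>
    Finset.sum_congr rfl fun m _ => ?_
  exact component_eq k S _ _ _ (D w' w).sum_proj_incl t

lemma sum_apply {κ : Type*} (s : Finset κ) (f : κ → Tube k S) (w x y : ι) :
    (∑ a ∈ s, f a) w x y = ∑ a ∈ s, f a w x y :=
  map_sum (AddMonoidHom.mk' (fun g : Tube k S => g w x y) fun _ _ => rfl) f s

lemma single_apply_same (w x y : ι) (f : S.obj x ⊗ S.obj w ⟶ S.obj w ⊗ S.obj y) :
    single k S w x y f w x y = f := by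
  simp [single]

lemma single_apply_of_ne (w x y : ι) (f : S.obj x ⊗ S.obj w ⟶ S.obj w ⊗ S.obj y) {w' x' y' : ι}
    (h : w' ≠ w ∨ x' ≠ x ∨ y' ≠ y) : single k S w x y f w' x' y' = 0 := by
  classical
  unfold single
  by_cases hw : w' = w
  · subst hw
    by_cases hx : x' = x
    · subst hx
      have hy : y' ≠ y := by simpa using h
      simp [hy]
    · simp [hx]
  · simp [hw]

lemma one_def : (1 : Tube k S) = ∑ x, single k S (unitIndex k S) x x (unitHom k S x) := rfl

lemma one_apply_same (x : ι) : (1 : Tube k S) (unitIndex k S) x x = unitHom k S x := by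
  rw [one_def, sum_apply, Finset.sum_eq_single x]
  · exact single_apply_same _ _ _ _
  · intro z _ hz
    exact single_apply_of_ne _ _ _ _ (Or.inr (Or.inl hz.symm))
  · simp

lemma one_apply_of_ne {w x y : ι} (h : w ≠ unitIndex k S ∨ x ≠ y) : (1 : Tube k S) w x y = 0 := by
  rw [one_def, sum_apply]
  refine Finset.sum_eq_zero fun z _ => single_apply_of_ne _ _ _ _ ?_
  rcases h with h | h
  · exact Or.inl h
  · by_cases hx : x = z
    · exact Or.inr (Or.inr fun hy => h (hx.trans hy.symm))
    · exact Or.inr (Or.inl hx)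

lemma stack_zero_left {A B D X Y : C} (g : B ⊗ Y ⟶ Y ⊗ D) :
    stack (0 : A ⊗ X ⟶ X ⊗ B) g = 0 := by
  simp [stack]

lemma stack_zero_right {A B D X Y : C} (h : A ⊗ X ⟶ X ⊗ B) :
    stack h (0 : B ⊗ Y ⟶ Y ⊗ D) = 0 := by
  simp [stack]

lemma stack_sum_left {A B D X Y : C} {κ : Type*} (s : Finset κ) (h : κ → (A ⊗ X ⟶ X ⊗ B))
    (g : B ⊗ Y ⟶ Y ⊗ D) : stack (∑ a ∈ s, h a) g = ∑ a ∈ s, stack (h a) g :=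
  map_sum (AddMonoidHom.mk' (fun h => stack h g) fun _ _ => stack_add_left _ _ _) _ _

lemma stack_sum_right {A B D X Y : C} {κ : Type*} (s : Finset κ) (h : A ⊗ X ⟶ X ⊗ B)
    (g : κ → (B ⊗ Y ⟶ Y ⊗ D)) : stack h (∑ a ∈ s, g a) = ∑ a ∈ s, stack h (g a) :=
  map_sum (AddMonoidHom.mk' (fun g => stack h g) fun _ _ => stack_add_right _ _ _) _ _

lemma stack_unit_left (x : ι) {Y D : C} (g : S.obj x ⊗ Y ⟶ Y ⊗ D) :
    stack (unitHom k S x) g =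
      conj ((unitIso k S).hom ▷ Y ≫ (λ_ Y).hom) ((λ_ Y).inv ≫ (unitIso k S).inv ▷ Y) g := by
  have h : unitHom k S x = conj (unitIso k S).hom (unitIso k S).inv
      ((ρ_ (S.obj x)).hom ≫ (λ_ (S.obj x)).inv) := by
    simp [unitHom, conj]
  rw [h, stack_conj_left, ← conj_conj]
  congr 1
  simp [stack, conj]

lemma stack_unit_right (x : ι) {A X : C} (g : A ⊗ X ⟶ X ⊗ S.obj x) :
    stack g (unitHom k S x) =
      conj (X ◁ (unitIso k S).hom ≫ (ρ_ X).hom) ((ρ_ X).inv ≫ X ◁ (unitIso k S).inv) g := by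
  have h : unitHom k S x = conj (unitIso k S).hom (unitIso k S).inv
      ((ρ_ (S.obj x)).hom ≫ (λ_ (S.obj x)).inv) := by
    simp [unitHom, conj]
  rw [h, stack_conj_right, ← conj_conj]
  congr 1
  simp [stack, conj]

protected lemma one_mul (g : Tube k S) : 1 * g = g := by
  ext t x y
  rw [mul_apply, Finset.sum_eq_single (unitIndex k S), Finset.sum_eq_single t,
    Finset.sum_eq_single x]
  · rw [one_apply_same, stack_unit_left]
    exact (component_conj_iso k S (whiskerRightIso (unitIso k S) (S.obj t) ≪≫ λ_ _) _ t).trans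
      (component_obj_self k S _)
  · intro m _ hm
    rw [one_apply_of_ne (Or.inr hm.symm), stack_zero_left, component_zero]
  · simp
  · intro j _ hj
    refine Finset.sum_eq_zero fun m _ => ?_
    by_cases hm : m = x
    · subst hm
      rw [one_apply_same, stack_unit_left]
      exact (component_conj_iso k S (whiskerRightIso (unitIso k S) (S.obj j) ≪≫ λ_ _) _ t).trans
        (component_obj_of_ne k S hj _)
    · rw [one_apply_of_ne (Or.inr (Ne.symm hm)), stack_zero_left, component_zero]
  · simp
  · intro i _ hi
    refine Finset.sum_eq_zero fun j _ => Finset.sum_eq_zero fun m _ => ?_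
    rw [one_apply_of_ne (Or.inl hi), stack_zero_left, component_zero]
  · simp

protected lemma mul_one (g : Tube k S) : g * 1 = g := by
  ext t x y
  rw [mul_apply, Finset.sum_eq_single t, Finset.sum_eq_single (unitIndex k S),
    Finset.sum_eq_single y]
  · rw [one_apply_same, stack_unit_right]
    exact (component_conj_iso k S (whiskerLeftIso (S.obj t) (unitIso k S) ≪≫ ρ_ _) _ t).trans
      (component_obj_self k S _)
  · intro m _ hm
    rw [one_apply_of_ne (Or.inr hm), stack_zero_right, component_zero]
  · simp
  · intro j _ hj
    refine Finset.sum_eq_zero fun m _ => ?_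
    rw [one_apply_of_ne (Or.inl hj), stack_zero_right, component_zero]
  · simp
  · intro i _ hi
    refine Finset.sum_eq_zero fun j _ => Finset.sum_eq_zero fun m _ => ?_
    by_cases hj : j = unitIndex k S
    · subst hj
      by_cases hm : m = y
      · subst hm
        rw [one_apply_same, stack_unit_right]
        exact (component_conj_iso k S (whiskerLeftIso (S.obj i) (unitIso k S) ≪≫ ρ_ _) _ t).trans
          (component_obj_of_ne k S hi _)
      · rw [one_apply_of_ne (Or.inr hm), stack_zero_right, component_zero]
    · rw [one_apply_of_ne (Or.inl hj), stack_zero_right, component_zero]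
  · simp

lemma sum_component_mul_left (f g : Tube k S) (x m : ι) {Y D : C} (h : S.obj m ⊗ Y ⟶ Y ⊗ D)
    (t : ι) : ∑ s, component k S (stack ((f * g) s x m) h) t =
      ∑ i, ∑ j, ∑ n, component k S (stack (stack (f i x n) (g j n m)) h) t := by
  simp only [mul_apply, stack_sum_left, component_sum]
  rw [Finset.sum_comm]
  refine Finset.sum_congr rfl fun i _ => ?_
  rw [Finset.sum_comm]
  refine Finset.sum_congr rfl fun j _ => ?_
  rw [Finset.sum_comm]
  exact Finset.sum_congr rfl fun n _ => stack_component_left k S _ _ _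

lemma sum_component_mul_right (g h : Tube k S) (n y : ι) {A X : C} (f : A ⊗ X ⟶ X ⊗ S.obj n)
    (t : ι) : ∑ s, component k S (stack f ((g * h) s n y)) t =
      ∑ i, ∑ j, ∑ m, component k S (stack f (stack (g i n m) (h j m y))) t := by
  simp only [mul_apply, stack_sum_right, component_sum]
  rw [Finset.sum_comm]
  refine Finset.sum_congr rfl fun i _ => ?_
  rw [Finset.sum_comm]
  refine Finset.sum_congr rfl fun j _ => ?_
  rw [Finset.sum_comm]
  exact Finset.sum_congr rfl fun m _ => stack_component_right k S _ _ _

protected lemma mul_assoc (f g h : Tube k S) : f * g * h = f * (g * h) := by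
  ext t x y
  have hl : (f * g * h) t x y = ∑ i, ∑ n, ∑ i', ∑ j, ∑ m,
      component k S (stack (stack (f i x n) (g i' n m)) (h j m y)) t := by
    calc (f * g * h) t x y
        = ∑ j, ∑ m, ∑ s, component k S (stack ((f * g) s x m) (h j m y)) t := by
          rw [mul_apply, Finset.sum_comm]
          exact Finset.sum_congr rfl fun j _ => Finset.sum_comm
      _ = ∑ j, ∑ m, ∑ i, ∑ n, ∑ i',
            component k S (stack (stack (f i x n) (g i' n m)) (h j m y)) t := by
          refine Finset.sum_congr rfl fun j _ => Finset.sum_congr rfl fun m _ => ?_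
          rw [sum_component_mul_left]
          exact Finset.sum_congr rfl fun i _ => Finset.sum_comm
      _ = ∑ p : ι × ι, ∑ q : ι × ι × ι, component k S
            (stack (stack (f q.1 x q.2.1) (g q.2.2 q.2.1 p.2)) (h p.1 p.2 y)) t := by
          simp only [Fintype.sum_prod_type]
      _ = _ := by
          rw [Finset.sum_comm]
          simp only [Fintype.sum_prod_type]
  have hr : (f * (g * h)) t x y = ∑ i, ∑ n, ∑ i', ∑ j, ∑ m,
      component k S (stack (f i x n) (stack (g i' n m) (h j m y))) t := by
    rw [mul_apply]
    refine Finset.sum_congr rfl fun i _ => ?_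
    rw [Finset.sum_comm]
    exact Finset.sum_congr rfl fun n _ => sum_component_mul_right _ _ _ _ _ _
  rw [hl, hr]
  refine Finset.sum_congr rfl fun i _ => Finset.sum_congr rfl fun n _ =>
    Finset.sum_congr rfl fun i' _ => Finset.sum_congr rfl fun j _ =>
      Finset.sum_congr rfl fun m _ => ?_
  rw [stack_assoc]
  exact component_conj_iso k S (α_ _ _ _) _ t

instance : Ring (Tube k S) where
  __ := (inferInstance : AddCommGroup (Tube k S))
  mul_assoc := Tube.mul_assoc
  one_mul := Tube.one_mul
  mul_one := Tube.mul_one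
  left_distrib f g h := by
    ext t x y
    simp [mul_apply, stack_add_right, component_add, Finset.sum_add_distrib]
  right_distrib f g h := by
    ext t x y
    simp [mul_apply, stack_add_left, component_add, Finset.sum_add_distrib]
  zero_mul g := by
    ext t x y
    simp [mul_apply, stack_zero_left, component_zero]
  mul_zero g := by
    ext t x y
    simp [mul_apply, stack_zero_right, component_zero]

instance : Algebra k (Tube k S) :=
  Algebra.ofModule
    (fun r g h => by
      ext t x y
      simp [mul_apply, stack_smul_left, component_smul, Finset.smul_sum])
    (fun r g h => by
      ext t x y
      simp [mul_apply, stack_smul_right, component_smul, Finset.smul_sum])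

end Tube

end Fusion

/-! ### Finite-dimensional representations -/

section Rep

open scoped ModuleCat in
/-- The category `Rep(A)` of finite-dimensional left modules over a `k`-algebra `A`. -/
abbrev FinDimRep (k : Type u') [Field k] (A : Type w) [Ring A] [Algebra k A] :=
  ObjectProperty.FullSubcategory fun M : ModuleCat.{w} A => FiniteDimensional k M

end Rep

/-! ### The action of the tube algebra -/

section Action

variable {C : Type u} [Category.{v} C] [MonoidalCategory C] [RigidCategory C]

/-- The half-braiding `γ_{w,z} : w ⊗ z ⟶ z ⊗ w` of an object `(z, γ)` of the Drinfeld center.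
(Mathlib records the inverse isomorphisms `z ⊗ w ≅ w ⊗ z`.) -/
def halfBraiding (Z : Center C) (W : C) : W ⊗ Z.1 ⟶ Z.1 ⊗ W := (Z.2.β W).inv

/-- For `g : x ⊗ w ⟶ w ⊗ y` and `s : y ⟶ z`, the composite
`x ⟶ x ⊗ w ⊗ w^L ⟶ w ⊗ y ⊗ w^L ⟶ w ⊗ z ⊗ w^L ⟶ z ⊗ w ⊗ w^L ⟶ z ⊗ w ⊗ w^R ⟶ z` of
`1 ⊗ coev`, `g ⊗ 1`, `1 ⊗ s ⊗ 1`, `γ_{w,z} ⊗ 1`, `1 ⊗ 𝔞_{w^L}` and `1 ⊗ ev`. -/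
def tubeAct (a : PivotalStructure C) (Z : Center C) {X Y W : C} (g : X ⊗ W ⟶ W ⊗ Y)
    (s : Y ⟶ Z.1) : X ⟶ Z.1 :=
  (ρ_ X).inv ≫ X ◁ lCoev W ≫ (α_ X W (lDual W)).inv ≫
    g ▷ lDual W ≫
    (W ◁ s) ▷ lDual W ≫
    halfBraiding Z W ▷ lDual W ≫
    (α_ Z.1 W (lDual W)).hom ≫
    Z.1 ◁ W ◁ a.appL W ≫
    Z.1 ◁ rEv W ≫ (ρ_ Z.1).hom

end Action

end TubeAlgebra

end

open TubeAlgebra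
open scoped ModuleCat

set_option linter.unusedSectionVars false

noncomputable section

/-! A half-braiding on an object `z` is the same thing as an action of all tubes `X ⊗ W ⟶ W ⊗ Y`,
with arbitrary boundaries and circumference, on the morphisms into `z`; the theorem is this
correspondence combined with semisimplicity.

The bridge is the partial trace `tr` over `W` built from the pivotal structure. It is cyclic
(`tr_cyclic`), it is multiplicative because the pivotal structure is monoidal (`tr_tensor`), and it
is nondegenerate because it transposes morphisms along a duality (`tr_contract_bijective`). A
half-braiding `γ` makes a tube `f` act on `s` by the trace of `f`, then `s`, then `γ`
(`tubeAct_eq_tr`). Conversely, nondegeneracy extracts from any `TubeAction` a unique family `W ⊗ z ⟶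
z ⊗ W`. Tested under traces, its naturality, unit and tensor axioms are the cyclicity, unit and
stacking axioms of the action. Invertibility comes for free from duals (`LaxHalfBraiding.iso`).

Semisimplicity reduces all tubes to those in the tube algebra. A tube of circumference `W` has
simple components, and the resulting map `Tube.lift` is cyclic and turns stacking into
multiplication. Boundaries are decomposed in the same way.

For essential surjectivity, a module `M` is the sum of its pieces `id_x M`. The object `z`
containing `x` with multiplicity `dim (id_x M)` has `C(x, z) ≅ id_x M`, which is a `Realization`.
The action on these spaces extends to all tubes, so `z` becomes an object of the center whose module
is `M` (`equivHomRep`). For full faithfulness, a module map commutes with the idempotents `id_x`, so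
it is a family of maps `C(x, z) ⟶ C(x, z')`; by semisimplicity this is composition with a unique
morphism, and commuting with tubes forces that morphism to commute with the half-braidings
(`comm_of_tubeAct`). -/

namespace TubeAlgebra

/-! ### Mates with respect to chosen duals -/

section Mates

variable {C : Type u} [Category.{v} C] [MonoidalCategory C]

/-- The mate `L₂ ⟶ L₁` of `f : X₁ ⟶ X₂` with respect to chosen exact pairings. -/
def lmate {L₁ X₁ L₂ X₂ : C} (p : ExactPairing L₁ X₁) (q : ExactPairing L₂ X₂) (f : X₁ ⟶ X₂) :
    L₂ ⟶ L₁ :=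
  @leftAdjointMate C _ _ X₁ X₂ ⟨L₁⟩ ⟨L₂⟩ f

/-- The evaluation of an exact pairing. -/
abbrev pev {L X : C} (p : ExactPairing L X) : X ⊗ L ⟶ 𝟙_ C := ε_ L X

lemma lmate_pev {L₁ X₁ L₂ X₂ : C} (p : ExactPairing L₁ X₁) (q : ExactPairing L₂ X₂)
    (f : X₁ ⟶ X₂) : X₁ ◁ lmate p q f ≫ pev p = f ▷ L₂ ≫ pev q :=
  @leftAdjointMate_comp_evaluation C _ _ X₁ X₂ ⟨L₁⟩ ⟨L₂⟩ f

/-- Up to a unitor, pairing with the evaluation is the inverse of the duality adjunction. Identities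
between mates can therefore be checked after evaluation. -/
lemma whiskerLeft_pev_cancel {L X Y : C} (p : ExactPairing L X) {m m' : Y ⟶ L}
    (h : X ◁ m ≫ pev p = X ◁ m' ≫ pev p) : m = m' := by
  have key : ∀ n : Y ⟶ L, tensorLeftHomEquiv Y L X (𝟙_ C) (X ◁ n ≫ ε_ L X) = n ≫ (ρ_ L).inv := by
    intro n
    apply (tensorLeftHomEquiv Y L X (𝟙_ C)).symm.injective
    rw [Equiv.symm_apply_apply]
    simp only [tensorLeftHomEquiv, Equiv.coe_fn_symm_mk, whiskerLeft_comp]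
    monoidal
  have := congrArg (tensorLeftHomEquiv Y L X (𝟙_ C)) h
  rw [key, key] at this
  simpa using this

lemma lmate_eq {L₁ X₁ L₂ X₂ : C} (p : ExactPairing L₁ X₁) (q : ExactPairing L₂ X₂)
    (f : X₁ ⟶ X₂) (m : L₂ ⟶ L₁) (h : X₁ ◁ m ≫ pev p = f ▷ L₂ ≫ pev q) : lmate p q f = m :=
  whiskerLeft_pev_cancel p ((lmate_pev p q f).trans h.symm)

lemma lmate_comp {L₁ X₁ L₂ X₂ L₃ X₃ : C} (p : ExactPairing L₁ X₁) (q : ExactPairing L₂ X₂)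
    (r : ExactPairing L₃ X₃) (f : X₁ ⟶ X₂) (g : X₂ ⟶ X₃) :
    lmate q r g ≫ lmate p q f = lmate p r (f ≫ g) := by
  symm
  apply lmate_eq
  rw [whiskerLeft_comp, Category.assoc, lmate_pev, whisker_exchange_assoc, lmate_pev]
  simp

/-- The evaluation of a tensor product is nested: `f` slides through the inner cap and then `g`
through the outer one. -/
lemma lmate_tensor {L₁ X₁ L₂ X₂ M₁ Y₁ M₂ Y₂ : C} (p : ExactPairing L₁ X₁)
    (q : ExactPairing L₂ X₂) (p' : ExactPairing M₁ Y₁) (q' : ExactPairing M₂ Y₂)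
    (f : X₁ ⟶ X₂) (g : Y₁ ⟶ Y₂) :
    lmate (ExactPairing.tensor (X₁ := L₁) (Y₁ := X₁) (X₂ := M₁) (Y₂ := Y₁))
      (ExactPairing.tensor (X₁ := L₂) (Y₁ := X₂) (X₂ := M₂) (Y₂ := Y₂)) (g ⊗ₘ f) =
    (lmate p q f ⊗ₘ lmate p' q' g) := by
  apply lmate_eq
  change _ ◁ _ ≫ (𝟙 _ ⊗≫ Y₁ ◁ (ε_ L₁ X₁ ▷ M₁) ⊗≫ ε_ M₁ Y₁) =
    _ ▷ _ ≫ (𝟙 _ ⊗≫ Y₂ ◁ (ε_ L₂ X₂ ▷ M₂) ⊗≫ ε_ M₂ Y₂)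
  have hp := lmate_pev p q f
  have hq := lmate_pev p' q' g
  simp only [pev] at hp hq
  calc _ = 𝟙 _ ⊗≫ Y₁ ◁ X₁ ◁ L₂ ◁ lmate p' q' g ⊗≫
        Y₁ ◁ (X₁ ◁ lmate p q f ≫ ε_ L₁ X₁) ▷ M₁ ⊗≫ ε_ M₁ Y₁ := by
        rw [tensorHom_def']; monoidal
    _ = 𝟙 _ ⊗≫ Y₁ ◁ ((X₁ ⊗ L₂) ◁ lmate p' q' g ≫ (f ▷ L₂ ≫ ε_ L₂ X₂) ▷ M₁) ⊗≫
        ε_ M₁ Y₁ := by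
        rw [hp]; monoidal
    _ = 𝟙 _ ⊗≫ Y₁ ◁ f ▷ L₂ ▷ M₂ ⊗≫ Y₁ ◁ (ε_ L₂ X₂ ▷ M₂) ⊗≫ (Y₁ ◁ lmate p' q' g ≫
        ε_ M₁ Y₁) := by
        rw [whisker_exchange]; monoidal
    _ = 𝟙 _ ⊗≫ Y₁ ◁ f ▷ L₂ ▷ M₂ ⊗≫ (Y₁ ◁ (ε_ L₂ X₂ ▷ M₂ ≫ (λ_ M₂).hom) ≫ g ▷ M₂) ⊗≫
        ε_ M₂ Y₂ := by
        rw [hq]; monoidal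
    _ = _ := by
        rw [whisker_exchange, tensorHom_def']; monoidal

end Mates

/-! ### Comparison of left and right duals through the pivotal structure. -/

section Duals

variable {C : Type u} [Category.{v} C] [MonoidalCategory C]

/-- The comparison is itself the mate of `𝟙 X` taken on the other side, so taking the mate back
returns the identity. -/
lemma lmate_rightDualIso {X Y₁ Y₂ : C} (p : ExactPairing X Y₁) (q : ExactPairing X Y₂) :
    lmate p q (rightDualIso p q).hom = 𝟙 X := by
  apply lmate_eq
  rw [whiskerLeft_id, Category.id_comp]
  have := @rightAdjointMate_comp_evaluation C _ _ X X ⟨Y₂⟩ ⟨Y₁⟩ (𝟙 X)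
  erw [whiskerLeft_id, Category.id_comp] at this
  exact this.symm

lemma lmate_rightDualIso_hom {R X Y₁ Y₂ : C} (r : ExactPairing R Y₁) (p : ExactPairing X Y₁)
    (q : ExactPairing X Y₂) : lmate r q (rightDualIso p q).hom = lmate r p (𝟙 Y₁) := by
  rw [← Category.id_comp (rightDualIso p q).hom, ← lmate_comp r p q, lmate_rightDualIso,
    Category.id_comp]

lemma coev_rightDualIso {X Y₁ Y₂ : C} (p : ExactPairing X Y₁) (q : ExactPairing X Y₂) :
    η_ X Y₁ ≫ X ◁ (rightDualIso p q).hom = η_ X Y₂ := by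
  have := @coevaluation_comp_rightAdjointMate C _ _ X X ⟨Y₂⟩ ⟨Y₁⟩ (𝟙 X)
  rw [id_whiskerRight, Category.comp_id] at this
  exact this

variable [RigidCategory C]

lemma rDualMap_eq {X Y : C} (f : X ⟶ Y) : rDualMap f = lmate (rPairing X) (rPairing Y) f := rfl

lemma rDualIso_hom {X Y : C} (p : ExactPairing Y X) :
    (rDualIso p).hom = lmate p (rPairing X) (𝟙 X) := rfl

lemma rDualIso_inv {X Y : C} (p : ExactPairing Y X) :
    (rDualIso p).inv = lmate (rPairing X) p (𝟙 X) := rfl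

/-- The left dual `f^L : Y^L ⟶ X^L` of a morphism `f : X ⟶ Y`. -/
def lDualMap {X Y : C} (f : X ⟶ Y) : lDual Y ⟶ lDual X := rightAdjointMate f

lemma lDualMap_ev {X Y : C} (f : X ⟶ Y) :
    lDualMap f ▷ X ≫ ε_ X (lDual X) = lDual Y ◁ f ≫ ε_ Y (lDual Y) :=
  rightAdjointMate_comp_evaluation f

lemma lCoev_lDualMap {X Y : C} (f : X ⟶ Y) :
    lCoev Y ≫ Y ◁ lDualMap f = lCoev X ≫ f ▷ lDual X :=
  coevaluation_comp_rightAdjointMate f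

namespace PivotalStructure

variable (a : PivotalStructure C)

/-- The components of a pivotal structure. -/
def app (X : C) : X ⟶ rDual (rDual X) := a.iso.hom.app X

lemma app_naturality {X Y : C} (f : X ⟶ Y) : a.app X ≫ rDualMap (rDualMap f) = f ≫ a.app Y :=
  (a.iso.hom.naturality f).symm

/-- The inverses of the components of a pivotal structure. -/
def appInv (X : C) : rDual (rDual X) ⟶ X := a.iso.inv.app X

lemma app_appInv (X : C) : a.app X ≫ a.appInv X = 𝟙 X := a.iso.hom_inv_id_app X

lemma appInv_app (X : C) : a.appInv X ≫ a.app X = 𝟙 _ := a.iso.inv_hom_id_app X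

lemma appL_eq (X : C) : a.appL X = a.app (lDual X) ≫ rDualMap (rDualIso (lPairing X)).inv := rfl

/-- The isomorphism `X^L ≅ X^R`. -/
def appLIso (X : C) : lDual X ≅ rDual X where
  hom := a.appL X
  inv := rDualMap (rDualIso (lPairing X)).hom ≫ a.appInv (lDual X)
  hom_inv_id := by
    rw [appL_eq, Category.assoc, ← Category.assoc (rDualMap _), ← rDualMap_comp, Iso.hom_inv_id,
      rDualMap_id, Category.id_comp, app_appInv]
  inv_hom_id := by
    rw [appL_eq, Category.assoc, ← Category.assoc (a.appInv _), appInv_app, Category.id_comp,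
      ← rDualMap_comp, Iso.inv_hom_id, rDualMap_id]

/-- The exact pairing of `X^L` with `X` given by the pivotal structure. -/
@[reducible]
def pairing (X : C) : ExactPairing (lDual X) X :=
  @exactPairingCongrLeft C _ _ _ _ _ (rPairing X) (a.appLIso X)

/-- The evaluation `X ⊗ X^L ⟶ 𝟙` given by the pivotal structure. -/
def ev (X : C) : X ⊗ lDual X ⟶ 𝟙_ C := X ◁ a.appL X ≫ rEv X

lemma appL_naturality {X Y : C} (f : X ⟶ Y) :
    a.appL Y ≫ rDualMap f = lDualMap f ≫ a.appL X := by
  -- `f` is recovered as the mate of `f^L`; once naturality of the pivotal structure is used, both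
  -- sides reduce to mates of `f^L`.
  have h : lmate (lPairing Y) (lPairing X) (lDualMap f) = f :=
    lmate_eq _ _ _ _ (lDualMap_ev f).symm
  rw [appL_eq, appL_eq, ← reassoc_of% (a.app_naturality (lDualMap f)), Category.assoc,
    ← rDualMap_comp, ← rDualMap_comp]
  congr 2
  rw [rDualIso_inv, rDualIso_inv, rDualMap_eq, lmate_comp, Category.comp_id]
  conv_lhs => rw [← h]
  rw [lmate_comp, Category.id_comp]

/-- The counterpart for caps of `lCoev_lDualMap` for cups; together they make the trace cyclic. -/
lemma ev_naturality {X Y : C} (f : X ⟶ Y) :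
    X ◁ lDualMap f ≫ a.ev X = f ▷ lDual Y ≫ a.ev Y := by
  have h2 : X ◁ rDualMap f ≫ rEv X = f ▷ rDual Y ≫ rEv Y := lmate_pev (rPairing X) (rPairing Y) f
  rw [ev, ev, ← whiskerLeft_comp_assoc, ← appL_naturality, whiskerLeft_comp_assoc, h2,
    whisker_exchange_assoc]

end PivotalStructure

/-- The comparison `(X ⊗ Y)^L ⟶ Y^L ⊗ X^L`. -/
def dualTensor (X Y : C) : lDual (X ⊗ Y) ⟶ lDual Y ⊗ lDual X :=
  (rightDualIso (lPairing (X ⊗ Y)) (ExactPairing.tensor (X₁ := X) (Y₁ := lDual X) (X₂ := Y)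
    (Y₂ := lDual Y))).hom

lemma coev_dualTensor (X Y : C) : lCoev (X ⊗ Y) ≫ (X ⊗ Y) ◁ dualTensor X Y =
    lCoev X ⊗≫ (X ◁ lCoev Y) ▷ lDual X ⊗≫ 𝟙 _ :=
  coev_rightDualIso (lPairing (X ⊗ Y)) _

variable (C) in
/-- The comparison `𝟙^L ⟶ 𝟙`. -/
def dualUnit : lDual (𝟙_ C) ⟶ 𝟙_ C :=
  (rightDualIso (lPairing (𝟙_ C)) (exactPairingUnit (C := C))).hom

lemma coev_dualUnit : lCoev (𝟙_ C) ≫ (𝟙_ C) ◁ dualUnit C = (ρ_ _).inv :=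
  coev_rightDualIso (lPairing (𝟙_ C)) _

namespace PivotalStructure

variable (a : PivotalStructure C)

/-- The tensor axiom of the pivotal structure enters here, as `ht`; the rest is composition of
mates. -/
lemma dualTensor_appL (X Y : C) : dualTensor X Y ≫ (a.appL Y ⊗ₘ a.appL X) =
    a.appL (X ⊗ Y) ≫ (rDualIso (ExactPairing.tensor (X₁ := rDual Y) (Y₁ := Y) (X₂ := rDual X)
    (Y₂ := X))).hom := by
  have ht : a.app (lDual Y ⊗ lDual X) ≫
      rDualMap (rDualIso (ExactPairing.tensor (X₁ := rDual (lDual X)) (Y₁ := lDual X)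
        (X₂ := rDual (lDual Y)) (Y₂ := lDual Y))).inv ≫
      (rDualIso (ExactPairing.tensor (X₁ := rDual (rDual (lDual Y))) (Y₁ := rDual (lDual Y))
        (X₂ := rDual (rDual (lDual X))) (Y₂ := rDual (lDual X)))).hom =
    (a.app (lDual Y) ⊗ₘ a.app (lDual X)) := a.tensor _ _
  -- Relative to the fixed partner `X ⊗ Y`, the comparison `dualTensor X Y` has the same mate as an
  -- identity, so it can be absorbed into chains of mates.
  have hu := lmate_rightDualIso_hom (rPairing (lDual (X ⊗ Y))) (lPairing (X ⊗ Y))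
    (ExactPairing.tensor (X₁ := X) (Y₁ := lDual X) (X₂ := Y) (Y₂ := lDual Y))
  rw [appL_eq, appL_eq, appL_eq, ← tensorHom_comp_tensorHom, ← ht, Category.assoc,
    ← reassoc_of% (a.app_naturality (dualTensor X Y)), Category.assoc, Category.assoc]
  refine congrArg (a.app _ ≫ ·) ?_
  simp only [rDualIso_hom, rDualIso_inv, rDualMap_eq]
  rw [← lmate_tensor, lmate_comp, lmate_comp, lmate_comp, lmate_comp]
  refine congrArg (lmate _ _) ?_
  rw [← lmate_tensor, id_tensorHom_id, Category.comp_id, Category.id_comp, ← hu, lmate_comp,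
    lmate_comp, Category.comp_id, Category.comp_id]
  rfl

/-- With `coev_dualTensor`, this allows the cup and cap of `X ⊗ Y` to be replaced by nested ones,
which makes the trace over a tensor product an iterated trace. -/
lemma ev_dualTensor (X Y : C) : (X ⊗ Y) ◁ dualTensor X Y ≫
    (𝟙 _ ⊗≫ X ◁ (a.ev Y ▷ lDual X) ⊗≫ a.ev X) = a.ev (X ⊗ Y) := by
  have h : (X ⊗ Y) ◁ (a.appL Y ⊗ₘ a.appL X) ≫ (𝟙 _ ⊗≫ X ◁ (rEv Y ▷ rDual X) ⊗≫ rEv X) =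
      𝟙 _ ⊗≫ X ◁ (a.ev Y ▷ lDual X) ⊗≫ a.ev X := by
    simp only [ev]
    calc _ = 𝟙 _ ⊗≫ X ◁ Y ◁ a.appL Y ▷ lDual X ⊗≫ X ◁ ((Y ⊗ rDual Y) ◁ a.appL X ≫
          rEv Y ▷ rDual X) ⊗≫ rEv X := by
          rw [MonoidalCategory.tensorHom_def]; monoidal
      _ = _ := by rw [whisker_exchange]; monoidal
  rw [← h, ← whiskerLeft_comp_assoc, dualTensor_appL, whiskerLeft_comp_assoc, rDualIso_hom]
  have := lmate_pev (ExactPairing.tensor (X₁ := rDual Y) (Y₁ := Y) (X₂ := rDual X)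
    (Y₂ := X)) (rPairing (X ⊗ Y)) (𝟙 _)
  rw [id_whiskerRight, Category.id_comp] at this
  exact congrArg ((X ⊗ Y) ◁ a.appL (X ⊗ Y) ≫ ·) this

lemma dualUnit_appL : dualUnit C =
    a.appL (𝟙_ C) ≫ (rDualIso (exactPairingUnit (C := C))).hom := by
  have ht : a.app (𝟙_ C) ≫ rDualMap (rDualIso (exactPairingUnit (C := C))).inv ≫
    (rDualIso (exactPairingUnit (C := C))).hom = 𝟙 (𝟙_ C) := a.unit
  have hu := lmate_rightDualIso_hom (rPairing (lDual (𝟙_ C))) (lPairing (𝟙_ C))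
    (exactPairingUnit (C := C))
  rw [appL_eq]
  conv_lhs => rw [← Category.comp_id (dualUnit C), ← ht]
  rw [← reassoc_of% (a.app_naturality (dualUnit C)), Category.assoc]
  refine congrArg (a.app _ ≫ ·) ?_
  simp only [rDualIso_hom, rDualIso_inv, rDualMap_eq, lmate_comp]
  rw [Category.id_comp, Category.id_comp, ← hu, lmate_comp, Category.comp_id]
  rfl

lemma ev_dualUnit : (𝟙_ C) ◁ dualUnit C ≫ (ρ_ _).hom = a.ev (𝟙_ C) := by
  rw [a.dualUnit_appL, whiskerLeft_comp_assoc, rDualIso_hom]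
  have := lmate_pev (exactPairingUnit (C := C)) (rPairing (𝟙_ C)) (𝟙 _)
  rw [id_whiskerRight, Category.id_comp] at this
  exact congrArg (_ ◁ a.appL (𝟙_ C) ≫ ·) this

end PivotalStructure

end Duals

/-! ### Partial traces -/

section PartialTrace

variable {C : Type u} [Category.{v} C] [MonoidalCategory C]

/-- The partial trace of `φ : X ⊗ W ⟶ Z ⊗ W` with respect to morphisms `𝟙 ⟶ W ⊗ D` and
`W ⊗ D ⟶ 𝟙`. -/
def ptr {W D X Z : C} (c : 𝟙_ C ⟶ W ⊗ D) (e : W ⊗ D ⟶ 𝟙_ C) (φ : X ⊗ W ⟶ Z ⊗ W) : X ⟶ Z :=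
  (ρ_ X).inv ≫ X ◁ c ≫ (α_ X W D).inv ≫ φ ▷ D ≫ (α_ Z W D).hom ≫ Z ◁ e ≫ (ρ_ Z).hom

lemma comp_ptr {W D X X' Z : C} (c : 𝟙_ C ⟶ W ⊗ D) (e : W ⊗ D ⟶ 𝟙_ C) (i : X' ⟶ X)
    (φ : X ⊗ W ⟶ Z ⊗ W) : i ≫ ptr c e φ = ptr c e (i ▷ W ≫ φ) := by
  simp only [ptr]
  calc _ = 𝟙 _ ⊗≫ (i ▷ _ ≫ X ◁ c) ⊗≫ φ ▷ D ⊗≫ Z ◁ e ⊗≫ 𝟙 _ := by monoidal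
    _ = _ := by rw [← whisker_exchange]; monoidal

lemma ptr_comp {W D X Z Z' : C} (c : 𝟙_ C ⟶ W ⊗ D) (e : W ⊗ D ⟶ 𝟙_ C) (φ : X ⊗ W ⟶ Z ⊗ W)
    (j : Z ⟶ Z') : ptr c e φ ≫ j = ptr c e (φ ≫ j ▷ W) := by
  simp only [ptr]
  calc _ = 𝟙 _ ⊗≫ X ◁ c ⊗≫ φ ▷ D ⊗≫ (Z ◁ e ≫ j ▷ _) ⊗≫ 𝟙 _ := by monoidal
    _ = _ := by rw [whisker_exchange]; monoidal

lemma whiskerLeft_ptr {W D X Z : C} (c : 𝟙_ C ⟶ W ⊗ D) (e : W ⊗ D ⟶ 𝟙_ C) (V : C)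
    (φ : X ⊗ W ⟶ Z ⊗ W) :
    V ◁ ptr c e φ = ptr c e ((α_ V X W).hom ≫ V ◁ φ ≫ (α_ V Z W).inv) := by
  simp only [ptr]
  monoidal

/-- Here `h'` plays the role of the dual of `h`: `hc` carries `h` through the cup to the dual
strand, interchange moves it past `φ`, and `he` brings it back at the cap. With `h = 𝟙` the lemma
also shows independence of the chosen dual. -/
lemma ptr_cyclic {W D W' D' X Z : C} {c : 𝟙_ C ⟶ W ⊗ D} {e : W ⊗ D ⟶ 𝟙_ C}
    {c' : 𝟙_ C ⟶ W' ⊗ D'} {e' : W' ⊗ D' ⟶ 𝟙_ C} (h : W ⟶ W') (h' : D' ⟶ D)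
    (hc : c' ≫ W' ◁ h' = c ≫ h ▷ D) (he : W ◁ h' ≫ e = h ▷ D' ≫ e') (φ : X ⊗ W' ⟶ Z ⊗ W) :
    ptr c e (X ◁ h ≫ φ) = ptr c' e' (φ ≫ Z ◁ h) := by
  simp only [ptr]
  calc _ = 𝟙 _ ⊗≫ X ◁ (c ≫ h ▷ D) ⊗≫ φ ▷ D ⊗≫ Z ◁ e ⊗≫ 𝟙 _ := by monoidal
    _ = 𝟙 _ ⊗≫ X ◁ c' ⊗≫ ((X ⊗ W') ◁ h' ≫ φ ▷ D) ⊗≫ Z ◁ e ⊗≫ 𝟙 _ := by rw [← hc]; monoidal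
    _ = 𝟙 _ ⊗≫ X ◁ c' ⊗≫ φ ▷ D' ⊗≫ Z ◁ (W ◁ h' ≫ e) ⊗≫ 𝟙 _ := by
      rw [whisker_exchange]; monoidal
    _ = _ := by rw [he]; monoidal

lemma ptr_tensor {V V' W W' X Z : C} (c : 𝟙_ C ⟶ V ⊗ V') (e : V ⊗ V' ⟶ 𝟙_ C)
    (c' : 𝟙_ C ⟶ W ⊗ W') (e' : W ⊗ W' ⟶ 𝟙_ C) (φ : X ⊗ V ⊗ W ⟶ Z ⊗ V ⊗ W) :
    ptr (c ⊗≫ (V ◁ c') ▷ V' ⊗≫ 𝟙 ((V ⊗ W) ⊗ W' ⊗ V')) (𝟙 _ ⊗≫ V ◁ (e' ▷ V') ⊗≫ e) φ =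
      ptr c e (ptr c' e' ((α_ X V W).hom ≫ φ ≫ (α_ Z V W).inv)) := by
  simp only [ptr]
  monoidal

lemma ptr_unit {X Z : C} (φ : X ⊗ 𝟙_ C ⟶ Z ⊗ 𝟙_ C) :
    ptr (ρ_ (𝟙_ C)).inv (ρ_ (𝟙_ C)).hom φ = (ρ_ X).inv ≫ φ ≫ (ρ_ Z).hom := by
  simp only [ptr]
  monoidal

end PartialTrace

/-! ### Cyclicity, multiplicativity and nondegeneracy of the pivotal partial trace. -/

section Pivotal

variable {C : Type u} [Category.{v} C] [MonoidalCategory C] [RigidCategory C]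

/-- Contraction of `W^L ⊗ W`. -/
def contract (Q W : C) : (Q ⊗ lDual W) ⊗ W ⟶ Q :=
  (α_ Q (lDual W) W).hom ≫ Q ◁ ε_ W (lDual W) ≫ (ρ_ Q).hom

/-- By the duality adjunction `contract` is universal among morphisms `X ⊗ W ⟶ Q`; with `comp_tr`,
statements about traces need checking only on it. -/
lemma exists_whiskerRight_contract {X Q W : C} (f : X ⊗ W ⟶ Q) :
    ∃ f' : X ⟶ Q ⊗ lDual W, f = f' ▷ W ≫ contract Q W := by
  refine ⟨tensorRightHomEquiv X W (lDual W) Q f, ?_⟩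
  exact ((tensorRightHomEquiv X W (lDual W) Q).symm_apply_apply f).symm

namespace PivotalStructure

variable (a : PivotalStructure C)

/-- The partial trace of `φ : X ⊗ W ⟶ Z ⊗ W` with respect to a pivotal structure. -/
def tr {X Z : C} (W : C) (φ : X ⊗ W ⟶ Z ⊗ W) : X ⟶ Z := ptr (lCoev W) (a.ev W) φ

lemma comp_tr {X X' Z : C} (W : C) (i : X' ⟶ X) (φ : X ⊗ W ⟶ Z ⊗ W) :
    i ≫ a.tr W φ = a.tr W (i ▷ W ≫ φ) := comp_ptr _ _ _ _

lemma tr_comp {X Z Z' : C} (W : C) (φ : X ⊗ W ⟶ Z ⊗ W) (j : Z ⟶ Z') :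
    a.tr W φ ≫ j = a.tr W (φ ≫ j ▷ W) := ptr_comp _ _ _ _

lemma whiskerLeft_tr {X Z : C} (V W : C) (φ : X ⊗ W ⟶ Z ⊗ W) :
    V ◁ a.tr W φ = a.tr W ((α_ V X W).hom ≫ V ◁ φ ≫ (α_ V Z W).inv) := whiskerLeft_ptr _ _ _ _

lemma tr_cyclic {X Z W W' : C} (h : W ⟶ W') (φ : X ⊗ W' ⟶ Z ⊗ W) :
    a.tr W (X ◁ h ≫ φ) = a.tr W' (φ ≫ Z ◁ h) :=
  ptr_cyclic h (lDualMap h) (lCoev_lDualMap h) (a.ev_naturality h) φ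

lemma tr_tensor {X Z V W : C} (φ : X ⊗ V ⊗ W ⟶ Z ⊗ V ⊗ W) :
    a.tr (V ⊗ W) φ = a.tr V (a.tr W ((α_ X V W).hom ≫ φ ≫ (α_ Z V W).inv)) := by
  simp only [tr]
  rw [← ptr_tensor]
  have h := ptr_cyclic (𝟙 (V ⊗ W)) (dualTensor V W)
    ((coev_dualTensor V W).trans (by rw [id_whiskerRight, Category.comp_id]))
    ((a.ev_dualTensor V W).trans (by rw [id_whiskerRight, Category.id_comp])) φ
  rw [whiskerLeft_id, whiskerLeft_id, Category.id_comp, Category.comp_id] at h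
  exact h.symm

lemma tr_unit {X Z : C} (φ : X ⊗ 𝟙_ C ⟶ Z ⊗ 𝟙_ C) :
    a.tr (𝟙_ C) φ = (ρ_ X).inv ≫ φ ≫ (ρ_ Z).hom := by
  simp only [tr]
  rw [← ptr_unit]
  have h := ptr_cyclic (𝟙 (𝟙_ C)) (dualUnit C)
    (coev_dualUnit.trans (by rw [id_whiskerRight, Category.comp_id]))
    (a.ev_dualUnit.trans (by rw [id_whiskerRight, Category.id_comp])) φ
  rw [whiskerLeft_id, whiskerLeft_id, Category.id_comp, Category.comp_id] at h
  exact h.symm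

/-- A zigzag cancels the cup of the trace against `contract`; what remains is transposition along
the pivotal pairing of `W^L` with `W`. -/
lemma tr_contract {Q Z W : C} (φ : Q ⟶ Z ⊗ W) :
    a.tr W (contract Q W ≫ φ) =
      (@tensorRightHomEquiv C _ _ Q (lDual W) W Z (a.pairing W)).symm φ := by
  change _ = φ ▷ _ ≫ (α_ _ _ _).hom ≫ _ ◁ a.ev W ≫ (ρ_ _).hom
  simp only [tr, ptr, lCoev]
  calc _ = 𝟙 _ ⊗≫ Q ◁ (lDual W ◁ η_ W (lDual W) ⊗≫ ε_ W (lDual W) ▷ lDual W) ⊗≫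
        φ ▷ lDual W ⊗≫ Z ◁ a.ev W ⊗≫ 𝟙 _ := by
        simp only [contract]; monoidal
    _ = _ := by rw [ExactPairing.coevaluation_evaluation'']; monoidal

/-- Injectivity proves identities between half-braidings, and surjectivity constructs them from
actions. -/
lemma tr_contract_bijective (Q Z W : C) :
    Function.Bijective fun φ : Q ⟶ Z ⊗ W => a.tr W (contract Q W ≫ φ) := by
  have : (fun φ : Q ⟶ Z ⊗ W => a.tr W (contract Q W ≫ φ)) =
      (@tensorRightHomEquiv C _ _ Q (lDual W) W Z (a.pairing W)).symm :=
    funext fun φ => a.tr_contract φ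
  rw [this]
  exact Equiv.bijective _

/-- Nondegeneracy of the partial trace. -/
lemma eq_of_tr_eq {Q Z W : C} {φ ψ : Q ⟶ Z ⊗ W}
    (h : ∀ (X : C) (f : X ⊗ W ⟶ Q), a.tr W (f ≫ φ) = a.tr W (f ≫ ψ)) : φ = ψ :=
  (a.tr_contract_bijective Q Z W).1 (h _ _)

/-- Stacks suffice as tests: the trace over `V ⊗ W` is iterated, and nondegeneracy applies first to
`V` with `f` varying, then to `W` with `g` a contraction. -/
lemma eq_of_tr_stack_eq {B Z V W : C} {φ ψ : (V ⊗ W) ⊗ B ⟶ Z ⊗ V ⊗ W}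
    (h : ∀ (X Y : C) (f : X ⊗ V ⟶ V ⊗ Y) (g : Y ⊗ W ⟶ W ⊗ B),
      a.tr (V ⊗ W) (stack f g ≫ φ) = a.tr (V ⊗ W) (stack f g ≫ ψ)) : φ = ψ := by
  have key : ∀ (X Y : C) (f : X ⊗ V ⟶ V ⊗ Y) (g : Y ⊗ W ⟶ W ⊗ B)
      (φ : (V ⊗ W) ⊗ B ⟶ Z ⊗ V ⊗ W), a.tr (V ⊗ W) (stack f g ≫ φ) =
      a.tr V (f ≫ a.tr W (((α_ V Y W).hom ≫ V ◁ g ≫ (α_ V W B).inv) ≫ φ ≫ (α_ Z V W).inv)) := by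
    intro X Y f g φ
    rw [tr_tensor, comp_tr]
    congr 2
    simp [stack]
  have h1 : ∀ (Y : C) (g : Y ⊗ W ⟶ W ⊗ B),
      a.tr W (((α_ V Y W).hom ≫ V ◁ g ≫ (α_ V W B).inv) ≫ φ ≫ (α_ Z V W).inv) =
      a.tr W (((α_ V Y W).hom ≫ V ◁ g ≫ (α_ V W B).inv) ≫ ψ ≫ (α_ Z V W).inv) := by
    intro Y g
    refine a.eq_of_tr_eq fun X f => ?_
    rw [← key, ← key, h]
  have h2 : φ ≫ (α_ Z V W).inv = ψ ≫ (α_ Z V W).inv := by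
    refine (a.tr_contract_bijective _ _ _).1 ?_
    -- The universal contraction for `W` comes, up to associators, from the choice `g = contract (W
    -- ⊗ B) W`.
    have e : contract ((V ⊗ W) ⊗ B) W = ((α_ V W B).hom ▷ _ ≫ (α_ V (W ⊗ B) (lDual W)).hom) ▷ W ≫
        (α_ V ((W ⊗ B) ⊗ lDual W) W).hom ≫ V ◁ contract (W ⊗ B) W ≫ (α_ V W B).inv := by
      simp only [contract]
      monoidal
    dsimp only
    rw [e, Category.assoc, Category.assoc _ _ (ψ ≫ _), ← comp_tr, ← comp_tr, h1]
  simpa using h2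

end PivotalStructure

end Pivotal

/-! ### Half-braidings from natural families of morphisms -/

section Invertibility

variable {C : Type u} [Category.{v} C] [MonoidalCategory C]

/-- A family of morphisms `W ⊗ z ⟶ z ⊗ W`, natural in `W` and compatible with tensor products and
the tensor unit. -/
structure LaxHalfBraiding (z : C) where
  /-- The morphism `W ⊗ z ⟶ z ⊗ W`. -/
  hom : ∀ W : C, W ⊗ z ⟶ z ⊗ W
  naturality : ∀ {V W : C} (h : V ⟶ W), h ▷ z ≫ hom W = hom V ≫ z ◁ h
  unit : hom (𝟙_ C) = (λ_ z).hom ≫ (ρ_ z).inv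
  tensor : ∀ V W : C, hom (V ⊗ W) =
    (α_ V W z).hom ≫ V ◁ hom W ≫ (α_ V z W).inv ≫ hom V ▷ W ≫ (α_ z V W).hom

namespace LaxHalfBraiding

variable {z : C} (b : LaxHalfBraiding z)

lemma tensor' (V W : C) : V ◁ b.hom W ⊗≫ b.hom V ▷ W =
    𝟙 _ ⊗≫ b.hom (V ⊗ W) ⊗≫ 𝟙 _ := by
  rw [b.tensor]
  monoidal

/-- The inverse of a natural family, obtained from a dual `W'` of `W`. -/
def inv (W W' : C) [ExactPairing W W'] : z ⊗ W ⟶ W ⊗ z :=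
  𝟙 _ ⊗≫ η_ W W' ▷ (z ⊗ W) ⊗≫ W ◁ b.hom W' ▷ W ⊗≫ (W ⊗ z) ◁ ε_ W W' ⊗≫ 𝟙 _

/-- The braidings with `W` and `W'` fuse into the one with `W ⊗ W'`. Naturality slides the
coevaluation through it, where the unit axiom trivializes it, and a zigzag remains. -/
lemma inv_hom (W W' : C) [ExactPairing W W'] : b.inv W W' ≫ b.hom W = 𝟙 (z ⊗ W) := by
  calc b.inv W W' ≫ b.hom W = 𝟙 _ ⊗≫ η_ W W' ▷ (z ⊗ W) ⊗≫ W ◁ b.hom W' ▷ W ⊗≫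
        ((W ⊗ z) ◁ ε_ W W' ≫ b.hom W ▷ 𝟙_ C) ⊗≫ 𝟙 _ := by rw [inv]; monoidal
    _ = 𝟙 _ ⊗≫ η_ W W' ▷ (z ⊗ W) ⊗≫ (W ◁ b.hom W' ⊗≫ b.hom W ▷ W') ▷ W ⊗≫
        (z ⊗ W) ◁ ε_ W W' ⊗≫ 𝟙 _ := by rw [whisker_exchange]; monoidal
    _ = 𝟙 _ ⊗≫ (η_ W W' ▷ z ≫ b.hom (W ⊗ W')) ▷ W ⊗≫ (z ⊗ W) ◁ ε_ W W' ⊗≫ 𝟙 _ := by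
        rw [b.tensor']; monoidal
    _ = 𝟙 _ ⊗≫ z ◁ (η_ W W' ▷ W ⊗≫ W ◁ ε_ W W') ⊗≫ 𝟙 _ := by
        rw [b.naturality, b.unit]; monoidal
    _ = 𝟙 _ := by rw [ExactPairing.evaluation_coevaluation'']; monoidal

/-- The same argument with `W' ⊗ W` and the evaluation. -/
lemma hom_inv (W W' : C) [ExactPairing W W'] : b.hom W ≫ b.inv W W' = 𝟙 (W ⊗ z) := by
  calc b.hom W ≫ b.inv W W' = 𝟙 _ ⊗≫ (𝟙_ C ◁ b.hom W ≫ η_ W W' ▷ (z ⊗ W)) ⊗≫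
        W ◁ b.hom W' ▷ W ⊗≫ (W ⊗ z) ◁ ε_ W W' ⊗≫ 𝟙 _ := by rw [inv]; monoidal
    _ = 𝟙 _ ⊗≫ η_ W W' ▷ (W ⊗ z) ⊗≫ W ◁ (W' ◁ b.hom W ⊗≫ b.hom W' ▷ W) ⊗≫
        (W ⊗ z) ◁ ε_ W W' ⊗≫ 𝟙 _ := by rw [whisker_exchange]; monoidal
    _ = 𝟙 _ ⊗≫ η_ W W' ▷ (W ⊗ z) ⊗≫ W ◁ (b.hom (W' ⊗ W) ≫ z ◁ ε_ W W') ⊗≫ 𝟙 _ := by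
        rw [b.tensor']; monoidal
    _ = 𝟙 _ ⊗≫ (η_ W W' ▷ W ⊗≫ W ◁ ε_ W W') ▷ z ⊗≫ 𝟙 _ := by
        rw [← b.naturality, b.unit]; monoidal
    _ = 𝟙 _ := by rw [ExactPairing.evaluation_coevaluation'']; monoidal

variable [RigidCategory C]

/-- The invertibility of a natural family of morphisms `W ⊗ z ⟶ z ⊗ W`. -/
def iso (W : C) : W ⊗ z ≅ z ⊗ W where
  hom := b.hom W
  inv := b.inv W (lDual W)
  hom_inv_id := b.hom_inv W _
  inv_hom_id := b.inv_hom W _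

/-- The object of the Drinfeld center given by a natural family of morphisms. -/
def toCenter : Center C :=
  ⟨z, { β := fun W => (b.iso W).symm
        monoidal := fun U U' => by
          rw [← cancel_mono (b.iso (U ⊗ U')).hom]
          have h := (b.iso (U ⊗ U')).inv_hom_id
          have hU : (b.iso U).inv ≫ b.hom U = 𝟙 _ := (b.iso U).inv_hom_id
          have hU' : (b.iso U').inv ≫ b.hom U' = 𝟙 _ := (b.iso U').inv_hom_id
          refine h.trans ?_
          change _ = _ ≫ b.hom (U ⊗ U')
          rw [b.tensor]
          simp only [Iso.symm_hom, Category.assoc, Iso.inv_hom_id_assoc]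
          rw [← whiskerLeft_comp_assoc, hU', whiskerLeft_id, Category.id_comp,
            Iso.hom_inv_id_assoc, ← comp_whiskerRight_assoc, hU]
          simp
        naturality := fun {U U'} f => by
          simp only [Iso.symm_hom]
          rw [Iso.comp_inv_eq, Category.assoc, Iso.eq_inv_comp]
          exact (b.naturality f).symm }⟩

end LaxHalfBraiding

lemma halfBraiding_naturality (Z : Center C) {V W : C} (h : V ⟶ W) :
    h ▷ Z.1 ≫ halfBraiding Z W = halfBraiding Z V ≫ Z.1 ◁ h := by
  rw [halfBraiding, halfBraiding, Iso.comp_inv_eq, Category.assoc, Iso.eq_inv_comp]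
  exact (Z.2.naturality h).symm

lemma halfBraiding_unit (Z : Center C) :
    halfBraiding Z (𝟙_ C) = (λ_ Z.1).hom ≫ (ρ_ Z.1).inv := by
  have h : (Z.2.β (𝟙_ C)).hom = (ρ_ Z.1).hom ≫ (λ_ Z.1).inv :=
    (congrArg Center.Hom.f (braiding_tensorUnit_right Z)).trans
      (congrArg ((ρ_ Z.1).hom ≫ ·) (Center.leftUnitor_inv_f Z))
  refine Iso.inv_ext (h ▸ ?_)
  simp

lemma halfBraiding_tensor (Z : Center C) (V W : C) : halfBraiding Z (V ⊗ W) =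
    (α_ V W Z.1).hom ≫ V ◁ halfBraiding Z W ≫ (α_ V Z.1 W).inv ≫ halfBraiding Z V ▷ W ≫
      (α_ Z.1 V W).hom := by
  rw [halfBraiding, ← cancel_epi (Z.2.β (V ⊗ W)).hom, Iso.hom_inv_id, Z.2.monoidal]
  simp [halfBraiding]

end Invertibility

/-! ### Actions of tubes with arbitrary boundary -/

section TubeAction

variable {C : Type u} [Category.{v} C] [MonoidalCategory C]

/-- An action of the morphisms `X ⊗ W ⟶ W ⊗ Y` on the functor of morphisms to `z`. -/
structure TubeAction (z : C) where
  /-- The action of `f` on `s`. -/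
  act : ∀ {X Y W : C}, (X ⊗ W ⟶ W ⊗ Y) → (Y ⟶ z) → (X ⟶ z)
  comp_act : ∀ {X' X Y W : C} (i : X' ⟶ X) (f : X ⊗ W ⟶ W ⊗ Y) (s : Y ⟶ z),
    i ≫ act f s = act (i ▷ W ≫ f) s
  act_comp : ∀ {X Y Y' W : C} (f : X ⊗ W ⟶ W ⊗ Y) (h : Y ⟶ Y') (s : Y' ⟶ z),
    act (f ≫ W ◁ h) s = act f (h ≫ s)
  act_cyclic : ∀ {X Y W W' : C} (h : W ⟶ W') (f : X ⊗ W' ⟶ W ⊗ Y) (s : Y ⟶ z),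
    act (X ◁ h ≫ f) s = act (f ≫ h ▷ Y) s
  act_unit : ∀ {X Y : C} (f : X ⊗ 𝟙_ C ⟶ 𝟙_ C ⊗ Y) (s : Y ⟶ z),
    act f s = (ρ_ X).inv ≫ f ≫ (λ_ Y).hom ≫ s
  act_stack : ∀ {X Y B V W : C} (f : X ⊗ V ⟶ V ⊗ Y) (g : Y ⊗ W ⟶ W ⊗ B) (s : B ⟶ z),
    act (stack f g) s = act f (act g s)

variable [RigidCategory C] (a : PivotalStructure C)

lemma tubeAct_eq_tr (Z : Center C) {X Y W : C} (f : X ⊗ W ⟶ W ⊗ Y) (s : Y ⟶ Z.1) :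
    tubeAct a Z f s = a.tr W (f ≫ W ◁ s ≫ halfBraiding Z W) := by
  simp only [tubeAct, PivotalStructure.tr, ptr, PivotalStructure.ev, comp_whiskerRight,
    whiskerLeft_comp, Category.assoc]

lemma stack_comp_whiskerLeft {X Y B Z V W : C} (f : X ⊗ V ⟶ V ⊗ Y) (g : Y ⊗ W ⟶ W ⊗ B)
    (s : B ⟶ Z) : stack f (g ≫ W ◁ s) = stack f g ≫ (V ⊗ W) ◁ s := by
  simp [stack]

lemma whiskerRight_comp_stack {X X' Y B V W : C} (i : X' ⟶ X) (f : X ⊗ V ⟶ V ⊗ Y)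
    (g : Y ⊗ W ⟶ W ⊗ B) : stack (i ▷ V ≫ f) g = i ▷ (V ⊗ W) ≫ stack f g := by
  simp [stack]

lemma stack_comp_comm {X Y Y' B V W : C} (f : X ⊗ V ⟶ V ⊗ Y) (h : Y ⟶ Y')
    (g : Y' ⊗ W ⟶ W ⊗ B) : stack (f ≫ V ◁ h) g = stack f (h ▷ W ≫ g) := by
  simp [stack]

/-- The partial trace of a stack followed by a pair of half-braidings. -/
lemma tr_stack {X Y B z V W : C} (f : X ⊗ V ⟶ V ⊗ Y) (g : Y ⊗ W ⟶ W ⊗ B)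
    (p : V ⊗ z ⟶ z ⊗ V) (q : W ⊗ B ⟶ z ⊗ W) :
    a.tr (V ⊗ W) (stack f g ≫ (α_ V W B).hom ≫ V ◁ q ≫ (α_ V z W).inv ≫ p ▷ W ≫
      (α_ z V W).hom) = a.tr V (f ≫ V ◁ a.tr W (g ≫ q) ≫ p) := by
  rw [a.tr_tensor, a.whiskerLeft_tr, a.tr_comp, a.comp_tr]
  congr 2
  simp [stack]

/-- The action of tubes given by an object of the Drinfeld center. -/
@[simps]
def tubeAction (Z : Center C) : TubeAction Z.1 where
  act f s := tubeAct a Z f s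
  comp_act i f s := by
    simp only [tubeAct_eq_tr, a.comp_tr, Category.assoc]
  act_comp f h s := by
    simp only [tubeAct_eq_tr, whiskerLeft_comp, Category.assoc]
  act_cyclic {X Y W W'} h f s := by
    simp only [tubeAct_eq_tr, Category.assoc]
    rw [a.tr_cyclic, ← whisker_exchange_assoc, halfBraiding_naturality]
    simp only [Category.assoc]
  act_unit f s := by
    rw [tubeAct_eq_tr, a.tr_unit, halfBraiding_unit]
    simp
  act_stack {X Y B V W} f g s := by
    rw [tubeAct_eq_tr, tubeAct_eq_tr, tubeAct_eq_tr, halfBraiding_tensor, ← tr_stack]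
    refine congrArg (a.tr (V ⊗ W)) (congrArg (stack f g ≫ ·) ?_)
    simp

namespace TubeAction

variable {z : C} (T : TubeAction z)

lemma exists_tr_contract_eq (W : C) : ∃ p : W ⊗ z ⟶ z ⊗ W,
    a.tr W (contract (W ⊗ z) W ≫ p) = T.act (contract (W ⊗ z) W) (𝟙 z) :=
  (a.tr_contract_bijective (W ⊗ z) z W).2 _

/-- The morphism `W ⊗ z ⟶ z ⊗ W` given by an action of tubes. -/
def braid (W : C) : W ⊗ z ⟶ z ⊗ W := (T.exists_tr_contract_eq a W).choose

/-- `braid` matches the action on one tube only, the contraction. Every tube with `s` absorbed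
factors through it, and both sides respect precomposition. -/
lemma act_eq_tr {X Y W : C} (f : X ⊗ W ⟶ W ⊗ Y) (s : Y ⟶ z) :
    T.act f s = a.tr W (f ≫ W ◁ s ≫ T.braid a W) := by
  obtain ⟨f', hf⟩ := exists_whiskerRight_contract (f ≫ W ◁ s)
  rw [← Category.comp_id s, ← T.act_comp, Category.comp_id, ← Category.assoc, hf, ← T.comp_act,
    Category.assoc, ← a.comp_tr, braid, (T.exists_tr_contract_eq a W).choose_spec]

lemma act_id_eq_tr {X W : C} (f : X ⊗ W ⟶ W ⊗ z) :
    T.act f (𝟙 z) = a.tr W (f ≫ T.braid a W) := by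
  rw [T.act_eq_tr a, whiskerLeft_id, Category.id_comp]

/-- The natural family of morphisms `W ⊗ z ⟶ z ⊗ W` given by an action of tubes. -/
def toLaxHalfBraiding : LaxHalfBraiding z where
  hom := T.braid a
  naturality {V W} h := by
    -- Under the trace, naturality becomes cyclicity of the action.
    refine a.eq_of_tr_eq fun X f => ?_
    rw [← Category.assoc, ← T.act_id_eq_tr, ← T.act_cyclic, T.act_id_eq_tr a, Category.assoc,
      a.tr_cyclic, Category.assoc]
  unit := by
    refine a.eq_of_tr_eq fun X f => ?_
    rw [← T.act_id_eq_tr, T.act_unit, a.tr_unit]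
    simp
  tensor V W := by
    -- Tested on stacks, the tensor axiom becomes compatibility of the action with stacking.
    refine a.eq_of_tr_stack_eq fun X Y f g => ?_
    rw [← T.act_id_eq_tr, T.act_stack, tr_stack, T.act_id_eq_tr a, T.act_eq_tr a]

lemma tubeAct_toCenter {X Y W : C} (f : X ⊗ W ⟶ W ⊗ Y) (s : Y ⟶ z) :
    tubeAct a (T.toLaxHalfBraiding a).toCenter f s = T.act f s :=
  (tubeAct_eq_tr a (T.toLaxHalfBraiding a).toCenter f s).trans (T.act_eq_tr a f s).symm

end TubeAction

/-- A morphism that commutes with the actions of tubes underlies a morphism of the Drinfeld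
center. -/
lemma comm_of_tubeAct {Z Z' : Center C} (f : Z.1 ⟶ Z'.1)
    (h : ∀ (X Y W : C) (g : X ⊗ W ⟶ W ⊗ Y) (s : Y ⟶ Z.1),
      tubeAct a Z g s ≫ f = tubeAct a Z' g (s ≫ f)) (U : C) :
    f ▷ U ≫ (Z'.2.β U).hom = (Z.2.β U).hom ≫ U ◁ f := by
  rw [← Iso.inv_comp_eq, ← Category.assoc, ← Iso.eq_comp_inv]
  change halfBraiding Z U ≫ f ▷ U = U ◁ f ≫ halfBraiding Z' U
  refine a.eq_of_tr_eq fun X g => ?_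
  -- Identity `s` already suffices, since the tubes `g` range over all tests in the nondegeneracy
  -- criterion.
  have := h X _ U g (𝟙 _)
  rw [tubeAct_eq_tr, tubeAct_eq_tr, a.tr_comp, Category.id_comp, whiskerLeft_id,
    Category.id_comp, Category.assoc] at this
  exact this

lemma tubeAct_comp {Z Z' : Center C} (f : Z ⟶ Z') {X Y W : C} (g : X ⊗ W ⟶ W ⊗ Y)
    (s : Y ⟶ Z.1) : tubeAct a Z g s ≫ f.f = tubeAct a Z' g (s ≫ f.f) := by
  have h : halfBraiding Z W ≫ f.f ▷ W = W ◁ f.f ≫ halfBraiding Z' W := by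
    rw [halfBraiding, halfBraiding, Iso.inv_comp_eq, ← Category.assoc, Iso.eq_comp_inv]
    exact f.comm W
  rw [tubeAct_eq_tr, tubeAct_eq_tr, a.tr_comp, whiskerLeft_comp]
  simp only [Category.assoc, h]

end TubeAction

/-! ### Linear algebra in the chosen decompositions -/

section Semisimple

variable (k : Type u') [Field k] [IsAlgClosed k] {ι : Type w} [Fintype ι] {C : Type u}
  [Category.{v} C] [Abelian C] [Linear k C] [MonoidalCategory C] [MonoidalPreadditive C]
  [MonoidalLinear k C] [RigidCategory C] [FusionCategory k C] (S : SimpleSystem ι C)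

/-- A morphism from a simple object is a combination of the inclusions. -/
lemma exists_eq_sum_incl {X : C} (t : ι) (j : S.obj t ⟶ X) :
    ∃ c : Fin ((decomp k S X).mult t) → k,
      (∀ a, j ≫ (decomp k S X).proj t a = c a • 𝟙 _) ∧
        j = ∑ a, c a • (decomp k S X).incl t a := by
  choose c hc using fun a => exists_smul_id k S t (j ≫ (decomp k S X).proj t a)
  refine ⟨c, fun a => (hc a).symm, ?_⟩
  conv_lhs => rw [← Category.comp_id j, ← (decomp k S X).sum_proj_incl, Preadditive.comp_sum]
  rw [Finset.sum_eq_single t]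
  · rw [Preadditive.comp_sum]
    refine Finset.sum_congr rfl fun a _ => ?_
    rw [← Category.assoc, ← hc a]
    simp
  · intro s _ hs
    rw [Preadditive.comp_sum]
    refine Finset.sum_eq_zero fun a _ => ?_
    rw [← Category.assoc, hom_eq_zero_of_ne S hs.symm (j ≫ (decomp k S X).proj s a), zero_comp]
  · simp

variable {k S} in
lemma hom_ext_incl {X Y : C} {f g : X ⟶ Y}
    (h : ∀ x a, (decomp k S X).incl x a ≫ f = (decomp k S X).incl x a ≫ g) : f = g := by
  rw [← Category.id_comp f, ← Category.id_comp g, ← (decomp k S X).sum_proj_incl]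
  simp only [Preadditive.sum_comp, Category.assoc, h]

/-- The morphism with given composites with morphisms from the simple objects. -/
def ofFamily {X Y : C} (F : ∀ x, (S.obj x ⟶ X) →ₗ[k] (S.obj x ⟶ Y)) : X ⟶ Y :=
  ∑ x, ∑ a, (decomp k S X).proj x a ≫ F x ((decomp k S X).incl x a)

lemma comp_ofFamily {X Y : C} (F : ∀ x, (S.obj x ⟶ X) →ₗ[k] (S.obj x ⟶ Y)) (x : ι)
    (i : S.obj x ⟶ X) : i ≫ ofFamily k S F = F x i := by
  obtain ⟨c, hc, hi⟩ := exists_eq_sum_incl k S x i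
  rw [ofFamily, Preadditive.comp_sum, Finset.sum_eq_single x]
  · conv_rhs => rw [hi, map_sum]
    rw [Preadditive.comp_sum]
    refine Finset.sum_congr rfl fun a _ => ?_
    rw [← Category.assoc, hc]
    simp
  · intro s _ hs
    rw [Preadditive.comp_sum]
    refine Finset.sum_eq_zero fun a _ => ?_
    rw [← Category.assoc, hom_eq_zero_of_ne S hs.symm (i ≫ (decomp k S X).proj s a), zero_comp]
  · simp

/-- Sums of bilinear expressions in the projections and inclusions of a decomposition are natural
in the decomposed object. -/
lemma sum_bilinear_comp {X Y : C} (t : ι) {A : Type*} [AddCommGroup A] [Module k A]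
    (Q : (X ⟶ S.obj t) →ₗ[k] (S.obj t ⟶ Y) →ₗ[k] A) (h : X ⟶ Y) :
    ∑ b, Q (h ≫ (decomp k S Y).proj t b) ((decomp k S Y).incl t b) =
      ∑ a, Q ((decomp k S X).proj t a) ((decomp k S X).incl t a ≫ h) := by
  choose c hc hI using fun a => exists_eq_sum_incl k S t ((decomp k S X).incl t a ≫ h)
  -- The matrix `c` of `h` on the multiplicity spaces of `t` also expands the projections, so both
  -- sides are the same double sum.
  have hP : ∀ b, h ≫ (decomp k S Y).proj t b = ∑ a, c a b • (decomp k S X).proj t a := by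
    intro b
    refine hom_ext_incl (k := k) (S := S) fun x a' => ?_
    generalize (decomp k S X).incl x a' = i
    by_cases hx : x = t
    · subst hx
      obtain ⟨d, hd, hi⟩ := exists_eq_sum_incl k S x i
      conv_lhs => rw [hi]
      rw [Preadditive.sum_comp, Preadditive.comp_sum]
      refine Finset.sum_congr rfl fun a _ => ?_
      have := hc a b
      rw [Category.assoc] at this
      rw [Linear.smul_comp, Linear.comp_smul, this, hd, smul_comm]
    · rw [hom_eq_zero_of_ne S hx (i ≫ _), hom_eq_zero_of_ne S hx (i ≫ _)]
  simp only [hP, hI, map_sum, map_smul, LinearMap.sum_apply, LinearMap.smul_apply]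
  exact Finset.sum_comm

/-- The linear map `f ↦ (A ◁ i ≫ f ≫ p ▷ B)` in the variables `p` and `i`. -/
def sandwich {A B X Y T : C} (f : A ⊗ Y ⟶ X ⊗ B) :
    (X ⟶ T) →ₗ[k] (T ⟶ Y) →ₗ[k] (A ⊗ T ⟶ T ⊗ B) :=
  LinearMap.mk₂ k (fun p i => A ◁ i ≫ f ≫ p ▷ B) (by intros; simp) (by intros; simp)
    (by intros; simp) (by intros; simp)

/-- Components are sums over projections and inclusions, hence natural in the decomposed object;
this gives tubes their trace-like invariance. -/
lemma component_cyclic {A B X Y : C} (h : X ⟶ Y) (f : A ⊗ Y ⟶ X ⊗ B) (t : ι) :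
    component k S (A ◁ h ≫ f) t = component k S (f ≫ h ▷ B) t := by
  have := sum_bilinear_comp k S t (sandwich k (A := A) (B := B) f) h
  simp only [sandwich, LinearMap.mk₂_apply, whiskerLeft_comp, comp_whiskerRight,
    Category.assoc] at this
  simp only [component, conj, Category.assoc]
  exact this.symm

/-- A bilinear expression is recovered from its restrictions to the simple summands. -/
lemma sum_bilinear_simple {y : ι} {A : Type*} [AddCommGroup A] [Module k A]
    (Q : ∀ t, (S.obj y ⟶ S.obj t) →ₗ[k] (S.obj t ⟶ S.obj y) →ₗ[k] A) :
    ∑ t, ∑ a, Q t ((decomp k S (S.obj y)).proj t a) ((decomp k S (S.obj y)).incl t a) =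
      Q y (𝟙 _) (𝟙 _) := by
  rw [Finset.sum_eq_single y]
  · have h : ∑ a, (decomp k S (S.obj y)).proj y a ≫ (decomp k S (S.obj y)).incl y a =
        𝟙 (S.obj y) := by
      conv_rhs => rw [← (decomp k S (S.obj y)).sum_proj_incl]
      symm
      refine Finset.sum_eq_single y (fun s _ hs => Finset.sum_eq_zero fun a _ => ?_) (by simp)
      rw [hom_eq_zero_of_ne S hs ((decomp k S (S.obj y)).incl s a), comp_zero]
    have h' : Q y (𝟙 _) (𝟙 _) = ∑ a, Q y ((decomp k S (S.obj y)).proj y a ≫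
        (decomp k S (S.obj y)).incl y a) (𝟙 _) := by
      rw [← LinearMap.sum_apply, ← map_sum, h]
    rw [h']
    refine Finset.sum_congr rfl fun a _ => ?_
    -- By Schur's lemma the inclusion is a scalar, so it can pass from the second argument of `Q` to
    -- the first.
    obtain ⟨c, hc⟩ := exists_smul_id k S y ((decomp k S (S.obj y)).incl y a)
    rw [← hc]
    simp
  · intro s _ hs
    refine Finset.sum_eq_zero fun a _ => ?_
    rw [hom_eq_zero_of_ne S hs ((decomp k S (S.obj y)).incl s a), map_zero]
  · simp

end Semisimple

/-! ### Elements of the tube algebra given by tubes of arbitrary circumference -/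

section Lift

variable (k : Type u') [Field k] [IsAlgClosed k] {ι : Type w} [Fintype ι] {C : Type u}
  [Category.{v} C] [Abelian C] [Linear k C] [MonoidalCategory C] [MonoidalPreadditive C]
  [MonoidalLinear k C] [RigidCategory C] [FusionCategory k C] (S : SimpleSystem ι C)

namespace Tube

/-- The element `∑_t` of the components of `f : x ⊗ W ⟶ W ⊗ y`. -/
def liftFun {x y : ι} {W : C} (f : S.obj x ⊗ W ⟶ W ⊗ S.obj y) : Tube k S :=
  ∑ t, single k S t x y (component k S f t)

variable {k S}

lemma liftFun_apply_same {x y : ι} {W : C} (f : S.obj x ⊗ W ⟶ W ⊗ S.obj y) (t : ι) :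
    liftFun k S f t x y = component k S f t := by
  rw [liftFun, sum_apply, Finset.sum_eq_single t]
  · exact single_apply_same _ _ _ _
  · intro s _ hs
    exact single_apply_of_ne _ _ _ _ (Or.inl hs.symm)
  · simp

lemma liftFun_apply_of_ne {x y : ι} {W : C} (f : S.obj x ⊗ W ⟶ W ⊗ S.obj y) {t x' y' : ι}
    (h : x' ≠ x ∨ y' ≠ y) : liftFun k S f t x' y' = 0 := by
  rw [liftFun, sum_apply]
  exact Finset.sum_eq_zero fun s _ => single_apply_of_ne _ _ _ _ (Or.inr h)

lemma ext_of_index {x y : ι} {f g : Tube k S} (h : ∀ t, f t x y = g t x y)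
    (hf : ∀ t x' y', x' ≠ x ∨ y' ≠ y → f t x' y' = 0)
    (hg : ∀ t x' y', x' ≠ x ∨ y' ≠ y → g t x' y' = 0) : f = g := by
  ext t x' y'
  by_cases hxy : x' ≠ x ∨ y' ≠ y
  · rw [hf _ _ _ hxy, hg _ _ _ hxy]
  · push Not at hxy
    obtain ⟨rfl, rfl⟩ := hxy
    exact h t

variable (k S)

/-- The element of the tube algebra given by `f : x ⊗ W ⟶ W ⊗ y`, as a linear map. -/
def lift (x y : ι) (W : C) : (S.obj x ⊗ W ⟶ W ⊗ S.obj y) →ₗ[k] Tube k S where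
  toFun f := liftFun k S f
  map_add' f g := by
    refine ext_of_index (x := x) (y := y) (fun t => ?_)
      (fun t x' y' h => liftFun_apply_of_ne _ h) (fun t x' y' h => ?_)
    · rw [add_apply, liftFun_apply_same, liftFun_apply_same, liftFun_apply_same, component_add]
    · rw [add_apply, liftFun_apply_of_ne _ h, liftFun_apply_of_ne _ h, add_zero]
  map_smul' r f := by
    refine ext_of_index (x := x) (y := y) (fun t => ?_)
      (fun t x' y' h => liftFun_apply_of_ne _ h) (fun t x' y' h => ?_)
    · rw [RingHom.id_apply, smul_apply, liftFun_apply_same, liftFun_apply_same, component_smul]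
    · rw [RingHom.id_apply, smul_apply, liftFun_apply_of_ne _ h, smul_zero]

variable {x y m m' : ι} {V W : C}

lemma lift_apply_same (f : S.obj x ⊗ W ⟶ W ⊗ S.obj y) (t : ι) :
    lift k S x y W f t x y = component k S f t := liftFun_apply_same f t

lemma lift_apply_of_ne (f : S.obj x ⊗ W ⟶ W ⊗ S.obj y) {t x' y' : ι}
    (h : x' ≠ x ∨ y' ≠ y) : lift k S x y W f t x' y' = 0 := liftFun_apply_of_ne f h

lemma lift_cyclic (h : V ⟶ W) (f : S.obj x ⊗ W ⟶ V ⊗ S.obj y) :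
    lift k S x y V (S.obj x ◁ h ≫ f) = lift k S x y W (f ≫ h ▷ S.obj y) := by
  refine ext_of_index (x := x) (y := y) (fun t => ?_)
    (fun t x' y' h => lift_apply_of_ne _ _ _ h) (fun t x' y' h => lift_apply_of_ne _ _ _ h)
  rw [lift_apply_same, lift_apply_same, component_cyclic]

lemma lift_conj_iso (e : V ≅ W) (f : S.obj x ⊗ W ⟶ W ⊗ S.obj y) :
    lift k S x y V (conj e.hom e.inv f) = lift k S x y W f := by
  rw [conj, lift_cyclic]
  simp

lemma lift_simple {w : ι} (f : S.obj x ⊗ S.obj w ⟶ S.obj w ⊗ S.obj y) :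
    lift k S x y (S.obj w) f = single k S w x y f := by
  refine ext_of_index (x := x) (y := y) (fun t => ?_)
    (fun t x' y' h => lift_apply_of_ne _ _ _ h)
    (fun t x' y' h => single_apply_of_ne _ _ _ _ (Or.inr h))
  rw [lift_apply_same]
  by_cases ht : t = w
  · subst ht
    rw [component_obj_self, single_apply_same]
  · rw [component_obj_of_ne _ _ (Ne.symm ht), single_apply_of_ne _ _ _ _ (Or.inl ht)]

lemma eq_sum_lift (g : Tube k S) :
    g = ∑ w, ∑ x, ∑ y, lift k S x y (S.obj w) (g w x y) := by
  ext w x y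
  simp only [sum_apply, lift_simple]
  rw [Finset.sum_eq_single w, Finset.sum_eq_single x, Finset.sum_eq_single y, single_apply_same]
  · intro y' _ h
    exact single_apply_of_ne _ _ _ _ (Or.inr (Or.inr h.symm))
  · simp
  · intro x' _ h
    exact Finset.sum_eq_zero fun _ _ => single_apply_of_ne _ _ _ _ (Or.inr (Or.inl h.symm))
  · simp
  · intro w' _ h
    exact Finset.sum_eq_zero fun _ _ => Finset.sum_eq_zero fun _ _ =>
      single_apply_of_ne _ _ _ _ (Or.inl h.symm)
  · simp

/-- Only the middle index `m` contributes; summing over the components of `V` and `W` reassembles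
the stack by `stack_component_left` and `stack_component_right`. -/
lemma lift_mul_lift (f : S.obj x ⊗ V ⟶ V ⊗ S.obj m) (g : S.obj m ⊗ W ⟶ W ⊗ S.obj y) :
    lift k S x m V f * lift k S m y W g = lift k S x y (V ⊗ W) (stack f g) := by
  refine ext_of_index (x := x) (y := y) (fun t => ?_) (fun t x' y' h => ?_)
    (fun t x' y' h => lift_apply_of_ne _ _ _ h)
  · rw [mul_apply, lift_apply_same, ← stack_component_right]
    rw [Finset.sum_comm]
    refine Finset.sum_congr rfl fun j _ => ?_
    rw [← stack_component_left]
    refine Finset.sum_congr rfl fun i _ => ?_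
    rw [Finset.sum_eq_single m]
    · rw [lift_apply_same, lift_apply_same]
    · intro n _ hn
      rw [lift_apply_of_ne _ _ _ (Or.inr hn), stack_zero_left, component_zero]
    · simp
  · rw [mul_apply]
    refine Finset.sum_eq_zero fun i _ => Finset.sum_eq_zero fun j _ =>
      Finset.sum_eq_zero fun n _ => ?_
    rcases h with h | h
    · rw [lift_apply_of_ne _ _ _ (Or.inl h), stack_zero_left, component_zero]
    · rw [lift_apply_of_ne _ _ g (Or.inr h), stack_zero_right, component_zero]

lemma lift_mul_lift_of_ne (h : m ≠ m') (f : S.obj x ⊗ V ⟶ V ⊗ S.obj m)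
    (g : S.obj m' ⊗ W ⟶ W ⊗ S.obj y) : lift k S x m V f * lift k S m' y W g = 0 := by
  ext t x' y'
  rw [mul_apply]
  refine Finset.sum_eq_zero fun i _ => Finset.sum_eq_zero fun j _ =>
    Finset.sum_eq_zero fun n _ => ?_
  by_cases hn : n = m
  · rw [lift_apply_of_ne _ _ g (Or.inl (hn.trans_ne h)), stack_zero_right, component_zero]
  · rw [lift_apply_of_ne _ _ f (Or.inr hn), stack_zero_left, component_zero]

/-- The idempotent `id_x` of the tube algebra. -/
def idem (x : ι) : Tube k S := lift k S x x (𝟙_ C) ((ρ_ (S.obj x)).hom ≫ (λ_ (S.obj x)).inv)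

lemma idem_eq_single (x : ι) : idem k S x = single k S (unitIndex k S) x x (unitHom k S x) := by
  have h : unitHom k S x = conj (unitIso k S).hom (unitIso k S).inv
      ((ρ_ (S.obj x)).hom ≫ (λ_ (S.obj x)).inv) := by
    simp [unitHom, conj]
  rw [← lift_simple, h, lift_conj_iso, idem]

lemma sum_idem : ∑ x, idem k S x = 1 := by
  simp only [idem_eq_single]
  rfl

lemma idem_mul_lift (f : S.obj x ⊗ W ⟶ W ⊗ S.obj y) :
    idem k S x * lift k S x y W f = lift k S x y W f := by
  have h : stack ((ρ_ (S.obj x)).hom ≫ (λ_ (S.obj x)).inv) f =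
      conj (λ_ W).hom (λ_ W).inv f := by
    simp [stack, conj]
  rw [idem, lift_mul_lift, h, lift_conj_iso]

lemma lift_mul_idem (f : S.obj x ⊗ W ⟶ W ⊗ S.obj y) :
    lift k S x y W f * idem k S y = lift k S x y W f := by
  have h : stack f ((ρ_ (S.obj y)).hom ≫ (λ_ (S.obj y)).inv) =
      conj (ρ_ W).hom (ρ_ W).inv f := by
    simp [stack, conj]
  rw [idem, lift_mul_lift, h, lift_conj_iso]

lemma idem_mul_lift_of_ne (h : m ≠ x) (f : S.obj x ⊗ W ⟶ W ⊗ S.obj y) :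
    idem k S m * lift k S x y W f = 0 := lift_mul_lift_of_ne k S h _ _

lemma idem_mul_idem (x : ι) : idem k S x * idem k S x = idem k S x := idem_mul_lift k S _

lemma idem_mul_idem_of_ne (h : m ≠ x) : idem k S m * idem k S x = 0 :=
  idem_mul_lift_of_ne k S h _

end Tube

end Lift

/-! ### The action of tubes with arbitrary boundary given by a module over the tube algebra -/

section Realization

variable (k : Type u') [Field k] [IsAlgClosed k] {ι : Type w} [Fintype ι] {C : Type u}
  [Category.{v} C] [Abelian C] [Linear k C] [MonoidalCategory C] [MonoidalPreadditive C]
  [MonoidalLinear k C] [RigidCategory C] [FusionCategory k C] (S : SimpleSystem ι C)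

/-- An identification of the summands `id_x M` of a module `M` over the tube algebra with the
spaces `C(x, z)` of morphisms to an object `z`. -/
structure Realization (M : Type*) [AddCommGroup M] [Module k M] [Module (Tube k S) M] (z : C) where
  /-- The inclusion of `C(x, z)`. -/
  inn : ∀ x, (S.obj x ⟶ z) →ₗ[k] M
  /-- The projection to `C(x, z)`. -/
  out : ∀ x, M →ₗ[k] (S.obj x ⟶ z)
  out_inn : ∀ x s, out x (inn x s) = s
  inn_out : ∀ x m, inn x (out x m) = Tube.idem k S x • m

namespace Realization

variable {k S} {M : Type*} [AddCommGroup M] [Module k M] [Module (Tube k S) M]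
  [IsScalarTower k (Tube k S) M] {z : C} (R : Realization k S M z)

lemma idem_smul_inn (x : ι) (s : S.obj x ⟶ z) : Tube.idem k S x • R.inn x s = R.inn x s := by
  rw [← R.inn_out, R.out_inn]

lemma out_idem_smul (x : ι) (m : M) : R.out x (Tube.idem k S x • m) = R.out x m := by
  rw [← R.inn_out, R.out_inn]

lemma out_idem_smul_of_ne {x y : ι} (h : x ≠ y) (m : M) :
    R.out x (Tube.idem k S y • m) = 0 := by
  rw [← R.out_idem_smul, smul_smul, Tube.idem_mul_idem_of_ne k S h, zero_smul, map_zero]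

/-- The action of `f : x ⊗ W ⟶ W ⊗ y` for simple `x` and `y`. -/
def simpleAct (x y : ι) (W : C) :
    (S.obj x ⊗ W ⟶ W ⊗ S.obj y) →ₗ[k] (S.obj y ⟶ z) →ₗ[k] (S.obj x ⟶ z) :=
  LinearMap.mk₂ k (fun f s => R.out x (Tube.lift k S x y W f • R.inn y s))
    (fun f f' s => by rw [map_add, add_smul, map_add])
    (fun c f s => by rw [map_smul (Tube.lift k S x y W), smul_assoc, map_smul (R.out x)])
    (fun f s s' => by rw [map_add, smul_add, map_add])
    (fun c f s => by rw [map_smul (R.inn y), smul_comm, map_smul (R.out x)])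

lemma simpleAct_apply {x y : ι} {W : C} (f : S.obj x ⊗ W ⟶ W ⊗ S.obj y) (s : S.obj y ⟶ z) :
    R.simpleAct x y W f s = R.out x (Tube.lift k S x y W f • R.inn y s) := rfl

lemma simpleAct_cyclic {x y : ι} {V W : C} (h : V ⟶ W) (f : S.obj x ⊗ W ⟶ V ⊗ S.obj y)
    (s : S.obj y ⟶ z) :
    R.simpleAct x y V (S.obj x ◁ h ≫ f) s = R.simpleAct x y W (f ≫ h ▷ S.obj y) s := by
  rw [simpleAct_apply, simpleAct_apply, Tube.lift_cyclic]

/-- Passing through `out` and `inn` inserts the idempotent `id_m`, which the lifted tube absorbs. -/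
lemma simpleAct_stack {x m y : ι} {V W : C} (f : S.obj x ⊗ V ⟶ V ⊗ S.obj m)
    (g : S.obj m ⊗ W ⟶ W ⊗ S.obj y) (s : S.obj y ⟶ z) :
    R.simpleAct x m V f (R.simpleAct m y W g s) = R.simpleAct x y (V ⊗ W) (stack f g) s := by
  rw [simpleAct_apply, simpleAct_apply, simpleAct_apply, R.inn_out, smul_smul, smul_smul,
    Tube.lift_mul_idem, Tube.lift_mul_lift]

lemma simpleAct_unit {x y : ι} (f : S.obj x ⊗ 𝟙_ C ⟶ 𝟙_ C ⊗ S.obj y) (s : S.obj y ⟶ z) :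
    R.simpleAct x y (𝟙_ C) f s = (ρ_ _).inv ≫ f ≫ (λ_ _).hom ≫ s := by
  have hf : f = (ρ_ _).hom ≫ ((ρ_ _).inv ≫ f ≫ (λ_ _).hom) ≫ (λ_ _).inv := by simp
  by_cases h : x = y
  · subst h
    obtain ⟨c, hc⟩ := exists_smul_id k S x ((ρ_ _).inv ≫ f ≫ (λ_ _).hom)
    -- By Schur's lemma `f` is a multiple of the tube whose lift is the idempotent `id_x`.
    have hf' : f = c • ((ρ_ _).hom ≫ (λ_ _).inv) := by
      rw [hf, ← hc]
      simp
    have h1 : R.simpleAct x x (𝟙_ C) ((ρ_ _).hom ≫ (λ_ _).inv) s = s := by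
      rw [simpleAct_apply]
      change R.out x (Tube.idem k S x • R.inn x s) = s
      rw [R.idem_smul_inn, R.out_inn]
    rw [hf', map_smul, LinearMap.smul_apply, h1]
    simp
  · have h0 := hom_eq_zero_of_ne S h ((ρ_ _).inv ≫ f ≫ (λ_ _).hom)
    rw [h0] at hf
    rw [hf]
    simp

/-- The bilinear map `(p, i) ↦ (f ≫ W ◁ p).(i ≫ s)`. -/
def midAct {x : ι} {W Y Y' : C} (f : S.obj x ⊗ W ⟶ W ⊗ Y) (s : Y' ⟶ z) (y : ι) :
    (Y ⟶ S.obj y) →ₗ[k] (S.obj y ⟶ Y') →ₗ[k] (S.obj x ⟶ z) :=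
  LinearMap.mk₂ k (fun p i => R.simpleAct x y W (f ≫ W ◁ p) (i ≫ s))
    (by intros; simp) (by intros; simp) (by intros; simp) (by intros; simp)

/-- The action of `f : x ⊗ W ⟶ W ⊗ Y` for simple `x`. -/
def semiAct {x : ι} {W Y : C} (f : S.obj x ⊗ W ⟶ W ⊗ Y) (s : Y ⟶ z) : S.obj x ⟶ z :=
  ∑ y, ∑ b, R.midAct f s y ((decomp k S Y).proj y b) ((decomp k S Y).incl y b)

lemma semiAct_eq {x : ι} {W Y : C} (f : S.obj x ⊗ W ⟶ W ⊗ Y) (s : Y ⟶ z) :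
    R.semiAct f s = ∑ y, ∑ b, R.simpleAct x y W (f ≫ W ◁ (decomp k S Y).proj y b)
      ((decomp k S Y).incl y b ≫ s) := rfl

lemma semiAct_simple {x y : ι} {W : C} (f : S.obj x ⊗ W ⟶ W ⊗ S.obj y) (s : S.obj y ⟶ z) :
    R.semiAct f s = R.simpleAct x y W f s := by
  rw [semiAct, sum_bilinear_simple]
  simp [midAct]

/-- The sum over the decomposition of the boundary is natural in that boundary, by
`sum_bilinear_comp`. -/
lemma semiAct_comp {x : ι} {W Y Y' : C} (f : S.obj x ⊗ W ⟶ W ⊗ Y) (h : Y ⟶ Y') (s : Y' ⟶ z) :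
    R.semiAct (f ≫ W ◁ h) s = R.semiAct f (h ≫ s) := by
  rw [semiAct_eq, semiAct_eq]
  refine Finset.sum_congr rfl fun y _ => ?_
  have := sum_bilinear_comp k S y (R.midAct f s y) h
  simpa [midAct] using this

lemma semiAct_add {x : ι} {W Y : C} (f f' : S.obj x ⊗ W ⟶ W ⊗ Y) (s : Y ⟶ z) :
    R.semiAct (f + f') s = R.semiAct f s + R.semiAct f' s := by
  simp only [semiAct_eq, Preadditive.add_comp, map_add, LinearMap.add_apply,
    Finset.sum_add_distrib]

lemma semiAct_smul {x : ι} {W Y : C} (c : k) (f : S.obj x ⊗ W ⟶ W ⊗ Y) (s : Y ⟶ z) :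
    R.semiAct (c • f) s = c • R.semiAct f s := by
  simp only [semiAct_eq, Linear.smul_comp, map_smul, LinearMap.smul_apply, Finset.smul_sum]

lemma semiAct_sum {x : ι} {W Y : C} {κ : Type*} (t : Finset κ)
    (f : κ → (S.obj x ⊗ W ⟶ W ⊗ Y)) (s : Y ⟶ z) :
    R.semiAct (∑ a ∈ t, f a) s = ∑ a ∈ t, R.semiAct (f a) s := by
  let Φ : (S.obj x ⊗ W ⟶ W ⊗ Y) →+ (S.obj x ⟶ z) :=
    AddMonoidHom.mk' (fun f => R.semiAct f s) fun f f' => R.semiAct_add f f' s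
  exact map_sum Φ f t

lemma semiAct_stack_simple {x m : ι} {V W B : C} (f : S.obj x ⊗ V ⟶ V ⊗ S.obj m)
    (g : S.obj m ⊗ W ⟶ W ⊗ B) (s : B ⟶ z) :
    R.semiAct (stack f g) s = R.simpleAct x m V f (R.semiAct g s) := by
  simp only [semiAct_eq, map_sum, simpleAct_stack, stack_comp_whiskerLeft]

lemma semiAct_stack {x : ι} {V W Y B : C} (f : S.obj x ⊗ V ⟶ V ⊗ Y) (g : Y ⊗ W ⟶ W ⊗ B)
    (s : B ⟶ z) : R.semiAct (stack f g) s =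
      ∑ y, ∑ b, R.simpleAct x y V (f ≫ V ◁ (decomp k S Y).proj y b)
        (R.semiAct ((decomp k S Y).incl y b ▷ W ≫ g) s) := by
  -- The identity of the middle boundary `Y` is split into simple summands.
  have h : stack f g = ∑ y, ∑ b, stack (f ≫ V ◁ (decomp k S Y).proj y b)
      ((decomp k S Y).incl y b ▷ W ≫ g) := by
    simp only [← stack_comp_comm, Category.assoc, ← whiskerLeft_comp]
    simp only [← Tube.stack_sum_left, ← Preadditive.comp_sum, ← whiskerLeft_sum,
      (decomp k S Y).sum_proj_incl]
    simp
  rw [h]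
  simp only [semiAct_sum, semiAct_stack_simple]

/-- The action of `f : X ⊗ W ⟶ W ⊗ Y`. -/
def fullAct {X Y W : C} (f : X ⊗ W ⟶ W ⊗ Y) (s : Y ⟶ z) : X ⟶ z :=
  ofFamily k S fun x =>
    { toFun := fun i => R.semiAct (i ▷ W ≫ f) s
      map_add' := fun i j => by
        rw [← semiAct_add, MonoidalPreadditive.add_whiskerRight, Preadditive.add_comp]
      map_smul' := fun c i => by
        rw [RingHom.id_apply, ← semiAct_smul, MonoidalLinear.smul_whiskerRight,
          Linear.smul_comp] }

lemma comp_fullAct {x : ι} {X Y W : C} (i : S.obj x ⟶ X) (f : X ⊗ W ⟶ W ⊗ Y) (s : Y ⟶ z) :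
    i ≫ R.fullAct f s = R.semiAct (i ▷ W ≫ f) s := comp_ofFamily k S _ x i

/-- The action of tubes given by a module over the tube algebra. -/
def tubeAction : TubeAction z where
  act f s := R.fullAct f s
  comp_act i f s := by
    refine hom_ext_incl (k := k) (S := S) fun x a => ?_
    rw [← Category.assoc, comp_fullAct, comp_fullAct, comp_whiskerRight, Category.assoc]
  act_comp f h s := by
    refine hom_ext_incl (k := k) (S := S) fun x a => ?_
    rw [comp_fullAct, comp_fullAct, ← Category.assoc, semiAct_comp]
  act_cyclic {X Y W W'} h f s := by
    refine hom_ext_incl (k := k) (S := S) fun x a => ?_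
    rw [comp_fullAct, comp_fullAct, ← Category.assoc, ← Category.assoc, ← whisker_exchange]
    simp only [semiAct_eq, Category.assoc]
    refine Finset.sum_congr rfl fun y _ => Finset.sum_congr rfl fun b _ => ?_
    rw [simpleAct_cyclic, Category.assoc, Category.assoc, whisker_exchange]
  act_unit {X Y} f s := by
    refine hom_ext_incl (k := k) (S := S) fun x a => ?_
    rw [comp_fullAct]
    have h : ∀ y b, R.simpleAct x y (𝟙_ C) (((decomp k S X).incl x a ▷ 𝟙_ C ≫ f) ≫
        𝟙_ C ◁ (decomp k S Y).proj y b) ((decomp k S Y).incl y b ≫ s) =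
        ((decomp k S X).incl x a ≫ (ρ_ X).inv ≫ f ≫ (λ_ Y).hom) ≫
          ((decomp k S Y).proj y b ≫ (decomp k S Y).incl y b) ≫ s := by
      intro y b
      rw [simpleAct_unit]
      simp
    simp only [semiAct_eq, h]
    simp only [← Preadditive.comp_sum, ← Preadditive.sum_comp, (decomp k S Y).sum_proj_incl]
    simp
  act_stack f g s := by
    refine hom_ext_incl (k := k) (S := S) fun x a => ?_
    rw [comp_fullAct, comp_fullAct, ← whiskerRight_comp_stack, semiAct_stack, semiAct_eq]
    simp only [comp_fullAct]

lemma tubeAction_act_simple {x y : ι} {W : C} (f : S.obj x ⊗ W ⟶ W ⊗ S.obj y)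
    (s : S.obj y ⟶ z) : R.tubeAction.act f s = R.simpleAct x y W f s := by
  rw [← Category.id_comp (R.tubeAction.act f s)]
  refine (R.comp_fullAct (𝟙 _) f s).trans ?_
  rw [semiAct_simple]
  simp

end Realization

end Realization

/-! ### The module over the tube algebra given by an object of the Drinfeld center -/

section HomRep

variable (k : Type u') [Field k] [IsAlgClosed k] {ι : Type w} [Fintype ι] {C : Type u}
  [Category.{v} C] [Abelian C] [Linear k C] [MonoidalCategory C] [MonoidalPreadditive C]
  [MonoidalLinear k C] [RigidCategory C] [FusionCategory k C] (S : SimpleSystem ι C)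

variable (a : PivotalStructure C)

/-- `tubeAct` as a bilinear map. -/
def tubeActLinear (Z : Center C) (X Y W : C) :
    (X ⊗ W ⟶ W ⊗ Y) →ₗ[k] (Y ⟶ Z.1) →ₗ[k] (X ⟶ Z.1) :=
  LinearMap.mk₂ k (fun g s => tubeAct a Z g s) (by intros; simp [tubeAct])
    (by intros; simp [tubeAct]) (by intros; simp [tubeAct]) (by intros; simp [tubeAct])

lemma tubeActLinear_apply (Z : Center C) {X Y W : C} (g : X ⊗ W ⟶ W ⊗ Y) (s : Y ⟶ Z.1) :
    tubeActLinear k a Z X Y W g s = tubeAct a Z g s := rfl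

/-- The action of a tube is the sum of the actions of its components. -/
lemma sum_tubeAct_component (Z : Center C) {X Y W : C} (g : X ⊗ W ⟶ W ⊗ Y) (s : Y ⟶ Z.1) :
    ∑ t, tubeAct a Z (component k S g t) s = tubeAct a Z g s := by
  -- Cyclicity carries the inclusion around the tube to meet its projection; the sum of these
  -- composites is `𝟙 W`.
  have h : ∀ t b, tubeAct a Z (conj ((decomp k S W).incl t b) ((decomp k S W).proj t b) g) s =
      tubeAct a Z (g ≫ ((decomp k S W).proj t b ≫ (decomp k S W).incl t b) ▷ Y) s := by
    intro t b
    refine ((tubeAction a Z).act_cyclic _ _ _).trans ?_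
    rw [tubeAction_act, comp_whiskerRight, Category.assoc]
  simp only [component, ← tubeActLinear_apply k, map_sum, LinearMap.sum_apply]
  simp only [tubeActLinear_apply, h]
  simp only [← tubeActLinear_apply k, ← LinearMap.sum_apply, ← map_sum, ← Preadditive.comp_sum,
    ← sum_whiskerRight, (decomp k S W).sum_proj_incl]
  simp

lemma tubeAct_eq_sum (Z : Center C) {X Y W : C} (g : X ⊗ W ⟶ W ⊗ Y) (s : Y ⟶ Z.1) :
    tubeAct a Z g s = ∑ y, ∑ b, tubeAct a Z (g ≫ W ◁ (decomp k S Y).proj y b)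
      ((decomp k S Y).incl y b ≫ s) := by
  have h : ∀ y b, tubeAct a Z (g ≫ W ◁ (decomp k S Y).proj y b) ((decomp k S Y).incl y b ≫ s) =
      tubeAct a Z g (((decomp k S Y).proj y b ≫ (decomp k S Y).incl y b) ≫ s) := by
    intro y b
    refine ((tubeAction a Z).act_comp _ _ _).trans ?_
    rw [tubeAction_act, Category.assoc]
  simp only [h, ← tubeActLinear_apply k, ← map_sum, ← Preadditive.sum_comp,
    (decomp k S Y).sum_proj_incl]
  simp

lemma sum_tubeAct_mul (Z : Center C) (g h : Tube k S) (x y : ι) (s : S.obj y ⟶ Z.1) :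
    ∑ t, tubeAct a Z ((g * h) t x y) s =
      ∑ i, ∑ m, ∑ j, tubeAct a Z (g i x m) (tubeAct a Z (h j m y) s) := by
  have hs : ∀ i m j, tubeAct a Z (g i x m) (tubeAct a Z (h j m y) s) =
      ∑ t, tubeAct a Z (component k S (stack (g i x m) (h j m y)) t) s := by
    intro i m j
    rw [sum_tubeAct_component]
    exact ((tubeAction a Z).act_stack _ _ _).symm
  simp only [hs]
  simp only [Tube.mul_apply, ← tubeActLinear_apply k, map_sum, LinearMap.sum_apply]
  refine Finset.sum_comm.trans (Finset.sum_congr rfl fun i _ => ?_)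
  refine Finset.sum_comm.trans (Eq.trans ?_ Finset.sum_comm)
  exact Finset.sum_congr rfl fun j _ => Finset.sum_comm

/-- The space `⨁_x C(x, z)` for an object `(z, γ)` of the Drinfeld center. -/
def HomRep (_k : Type u') {ι : Type w} {C : Type u} [Category.{v} C] [Abelian C]
    [MonoidalCategory C] [RigidCategory C] (S : SimpleSystem ι C) (_a : PivotalStructure C)
    (Z : Center C) : Type (max w v) :=
  ∀ x : ι, S.obj x ⟶ Z.1

namespace HomRep

variable (Z : Center C)

instance : AddCommGroup (HomRep k S a Z) :=
  inferInstanceAs (AddCommGroup (∀ x : ι, S.obj x ⟶ Z.1))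

instance : Module k (HomRep k S a Z) :=
  inferInstanceAs (Module k (∀ x : ι, S.obj x ⟶ Z.1))

variable {k S a Z}

@[ext] lemma ext {s t : HomRep k S a Z} (h : ∀ x, s x = t x) : s = t := funext h

lemma add_apply (s t : HomRep k S a Z) (x : ι) : (s + t) x = s x + t x := rfl

lemma smul_apply (c : k) (s : HomRep k S a Z) (x : ι) : (c • s) x = c • s x := rfl

lemma zero_apply (x : ι) : (0 : HomRep k S a Z) x = 0 := rfl

instance : SMul (Tube k S) (HomRep k S a Z) :=
  ⟨fun g s x => ∑ w, ∑ y, tubeAct a Z (g w x y) (s y)⟩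

lemma tube_smul_apply (g : Tube k S) (s : HomRep k S a Z) (x : ι) :
    (g • s) x = ∑ w, ∑ y, tubeAct a Z (g w x y) (s y) := rfl

lemma tube_smul_apply' (g : Tube k S) (s : HomRep k S a Z) (x : ι) :
    (g • s) x = ∑ w, ∑ y, tubeActLinear k a Z _ _ _ (g w x y) (s y) := rfl

lemma lift_smul_apply {x y : ι} {W : C} (g : S.obj x ⊗ W ⟶ W ⊗ S.obj y)
    (s : HomRep k S a Z) : (Tube.lift k S x y W g • s) x = tubeAct a Z g (s y) := by
  rw [tube_smul_apply, ← sum_tubeAct_component k S]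
  refine Finset.sum_congr rfl fun t _ => ?_
  rw [Finset.sum_eq_single y, Tube.lift_apply_same]
  · intro m _ hm
    rw [Tube.lift_apply_of_ne _ _ _ (Or.inr hm), ← tubeActLinear_apply k, map_zero,
      LinearMap.zero_apply]
  · simp

lemma lift_smul_apply_of_ne {x y x' : ι} (h : x' ≠ x) {W : C}
    (g : S.obj x ⊗ W ⟶ W ⊗ S.obj y) (s : HomRep k S a Z) :
    (Tube.lift k S x y W g • s) x' = 0 := by
  rw [tube_smul_apply]
  refine Finset.sum_eq_zero fun t _ => Finset.sum_eq_zero fun m _ => ?_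
  rw [Tube.lift_apply_of_ne _ _ _ (Or.inl h), ← tubeActLinear_apply k, map_zero,
    LinearMap.zero_apply]

lemma idem_smul_apply (x : ι) (s : HomRep k S a Z) : (Tube.idem k S x • s) x = s x := by
  rw [Tube.idem, lift_smul_apply]
  refine ((tubeAction a Z).act_unit _ _).trans ?_
  simp

lemma idem_smul_apply_of_ne {x y : ι} (h : y ≠ x) (s : HomRep k S a Z) :
    (Tube.idem k S x • s) y = 0 := lift_smul_apply_of_ne h _ s

lemma tube_add_smul (g h : Tube k S) (s : HomRep k S a Z) : (g + h) • s = g • s + h • s := by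
  ext x
  simp [tube_smul_apply', add_apply, Finset.sum_add_distrib]

lemma tube_one_smul (s : HomRep k S a Z) : (1 : Tube k S) • s = s := by
  ext x
  let Φ : Tube k S →+ (S.obj x ⟶ Z.1) := AddMonoidHom.mk' (fun g => (g • s) x) fun g h => by
    rw [tube_add_smul, add_apply]
  change Φ 1 = s x
  rw [← Tube.sum_idem, map_sum, Finset.sum_eq_single x]
  · exact idem_smul_apply x s
  · intro y _ h
    exact idem_smul_apply_of_ne h.symm s
  · simp

lemma tube_mul_smul (g h : Tube k S) (s : HomRep k S a Z) : (g * h) • s = g • h • s := by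
  ext x
  rw [tube_smul_apply, Finset.sum_comm]
  simp only [sum_tubeAct_mul]
  simp only [tube_smul_apply' g, tube_smul_apply' h, map_sum, tubeActLinear_apply]
  refine Finset.sum_comm.trans (Finset.sum_congr rfl fun i _ => ?_)
  refine Finset.sum_comm.trans (Finset.sum_congr rfl fun m _ => ?_)
  exact Finset.sum_comm

instance : Module (Tube k S) (HomRep k S a Z) where
  one_smul := tube_one_smul
  mul_smul := tube_mul_smul
  smul_zero g := by
    ext x
    simp [tube_smul_apply', zero_apply]
  smul_add g s t := by
    ext x
    simp [tube_smul_apply', add_apply, Finset.sum_add_distrib]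
  add_smul := tube_add_smul
  zero_smul s := by
    ext x
    simp [tube_smul_apply', zero_apply]

instance : IsScalarTower k (Tube k S) (HomRep k S a Z) where
  smul_assoc c g s := by
    ext x
    simp [tube_smul_apply', smul_apply, Finset.smul_sum]

end HomRep

end HomRep

/-! ### Existence of realizations -/

section Existence

variable (k : Type u') [Field k] [IsAlgClosed k] {ι : Type w} [Fintype ι] {C : Type u}
  [Category.{v} C] [Abelian C] [Linear k C] [MonoidalCategory C] [MonoidalPreadditive C]
  [MonoidalLinear k C] [RigidCategory C] [FusionCategory k C] (S : SimpleSystem ι C)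

section

attribute [local instance] Abelian.hasFiniteBiproducts

/-- There are objects with prescribed multiplicities of the simple objects. -/
lemma exists_obj_hom_equiv (n : ι → ℕ) :
    ∃ z : C, ∀ x, Nonempty ((Fin (n x) → k) ≃ₗ[k] (S.obj x ⟶ z)) := by
  let F : (Σ x, Fin (n x)) → C := fun p => S.obj p.1
  refine ⟨⨁ F, fun x => ⟨LinearEquiv.ofBijective
    (Fintype.linearCombination k fun j : Fin (n x) => biproduct.ι F ⟨x, j⟩) ⟨?_, ?_⟩⟩⟩
  · rw [← LinearMap.ker_eq_bot, LinearMap.ker_eq_bot']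
    intro c hc
    have := S.simple x
    funext j
    have h := congrArg (· ≫ biproduct.π F ⟨x, j⟩) hc
    simp only [Fintype.linearCombination_apply, Preadditive.sum_comp, Linear.smul_comp,
      zero_comp] at h
    rw [Finset.sum_eq_single j] at h
    · rw [biproduct.ι_π_self] at h
      exact (smul_eq_zero.mp h).resolve_right (id_nonzero (S.obj x))
    · intro i _ hi
      rw [biproduct.ι_π_ne F (fun h => hi (by simpa using h)), smul_zero]
    · simp
  · intro f
    -- By Schur's lemma, the coordinates of `f` in the copies of `x` are scalars; its other
    -- coordinates vanish.
    choose c hc using fun j : Fin (n x) => exists_smul_id k S x (f ≫ biproduct.π F ⟨x, j⟩)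
    refine ⟨c, biproduct.hom_ext _ _ ?_⟩
    rintro ⟨y, i⟩
    by_cases hy : x = y
    · subst hy
      rw [Fintype.linearCombination_apply, Preadditive.sum_comp, Finset.sum_eq_single i, ← hc,
        Linear.smul_comp, biproduct.ι_π_self]
      · intro j _ hj
        rw [Linear.smul_comp, biproduct.ι_π_ne F (fun h => hj (by simpa using h)), smul_zero]
      · simp
    · exact (hom_eq_zero_of_ne S hy _).trans (hom_eq_zero_of_ne S hy _).symm

end

/-- The multiplicity of `x` in `z` is chosen to be the dimension of `id_x M`, the range of `E x`. -/
lemma exists_realization (M : Type*) [AddCommGroup M] [Module k M] [Module (Tube k S) M]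
    [IsScalarTower k (Tube k S) M] [FiniteDimensional k M] :
    ∃ z : C, Nonempty (Realization k S M z) := by
  let E : ∀ x, M →ₗ[k] M := fun x => Algebra.lsmul k k M (Tube.idem k S x)
  have hE : ∀ x m, E x m = Tube.idem k S x • m := fun x m => rfl
  let φ : ∀ x, LinearMap.range (E x) ≃ₗ[k] (Fin (Module.finrank k (LinearMap.range (E x))) → k) :=
    fun x => (Module.finBasis k (LinearMap.range (E x))).equivFun
  obtain ⟨z, hz⟩ := exists_obj_hom_equiv k S fun x => Module.finrank k (LinearMap.range (E x))
  let ψ := fun x => φ x ≪≫ₗ (hz x).some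
  refine ⟨z, ⟨fun x => (LinearMap.range (E x)).subtype ∘ₗ (ψ x).symm.toLinearMap,
    fun x => (ψ x).toLinearMap ∘ₗ (E x).rangeRestrict, fun x s => ?_, fun x m => ?_⟩⟩
  -- An idempotent acts as the identity on its range.
  · have h : (E x).rangeRestrict ((ψ x).symm s) = (ψ x).symm s := by
      obtain ⟨m, hm⟩ := ((ψ x).symm s).2
      refine Subtype.ext ?_
      change E x _ = _
      rw [← hm, hE, hE, smul_smul, Tube.idem_mul_idem]
    simp [h]
  · simp [hE]

end Existence

/-! ### Modules over the tube algebra as modules of objects of the center. -/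

section Comparison

variable (k : Type u') [Field k] [IsAlgClosed k] {ι : Type w} [Fintype ι] {C : Type u}
  [Category.{v} C] [Abelian C] [Linear k C] [MonoidalCategory C] [MonoidalPreadditive C]
  [MonoidalLinear k C] [RigidCategory C] [FusionCategory k C] (S : SimpleSystem ι C)

variable {k S} {M : Type*} [AddCommGroup M] [Module k M] [Module (Tube k S) M]
  [IsScalarTower k (Tube k S) M] {z : C} (R : Realization k S M z) (a : PivotalStructure C)

namespace Realization

/-- The object of the Drinfeld center given by a module over the tube algebra. -/
def center : Center C := (R.tubeAction.toLaxHalfBraiding a).toCenter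

lemma tubeAct_center {x y : ι} {W : C} (f : S.obj x ⊗ W ⟶ W ⊗ S.obj y) (s : S.obj y ⟶ z) :
    tubeAct a (R.center a) f s = R.simpleAct x y W f s :=
  (R.tubeAction.tubeAct_toCenter a f s).trans (R.tubeAction_act_simple f s)

lemma sum_inn_out (m : M) : ∑ x, R.inn x (R.out x m) = m := by
  simp only [R.inn_out]
  rw [← Finset.sum_smul, Tube.sum_idem, one_smul]

lemma out_inn_of_ne {x y : ι} (h : x ≠ y) (s : S.obj y ⟶ z) : R.out x (R.inn y s) = 0 := by
  rw [← R.idem_smul_inn, R.out_idem_smul_of_ne h]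

/-- The morphisms to `z` given by an element of a module. -/
def toHomRep : M →+ HomRep k S a (R.center a) where
  toFun m x := R.out x m
  map_zero' := funext fun x => map_zero (R.out x)
  map_add' m m' := funext fun x => map_add (R.out x) m m'

lemma toHomRep_apply (m : M) (x : ι) : R.toHomRep a m x = R.out x m := rfl

lemma toHomRep_smul (g : Tube k S) (m : M) :
    R.toHomRep a (g • m) = g • R.toHomRep a m := by
  -- By additivity it is enough to treat single tubes with simple boundaries.
  conv_lhs => rw [Tube.eq_sum_lift k S g]
  conv_rhs => rw [Tube.eq_sum_lift k S g]
  simp only [Finset.sum_smul, map_sum]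
  refine Finset.sum_congr rfl fun w _ => Finset.sum_congr rfl fun x _ =>
    Finset.sum_congr rfl fun y _ => HomRep.ext fun x' => ?_
  rw [toHomRep_apply]
  by_cases h : x' = x
  · subst h
    rw [HomRep.lift_smul_apply]
    refine Eq.trans ?_ (R.tubeAct_center a (g w x' y) (R.out y m)).symm
    rw [simpleAct_apply, R.inn_out, smul_smul, Tube.lift_mul_idem]
  -- A tube starting at `x` absorbs `id_x` on the left, and the projection to another index kills
  -- it.
  · rw [HomRep.lift_smul_apply_of_ne h, ← Tube.idem_mul_lift, ← smul_smul,
      R.out_idem_smul_of_ne h]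
    rfl

/-- A module over the tube algebra is isomorphic to the module of an object of the center. -/
def equivHomRep : M ≃ₗ[Tube k S] HomRep k S a (R.center a) where
  __ := R.toHomRep a
  map_smul' := R.toHomRep_smul a
  invFun s := ∑ x, R.inn x (s x)
  left_inv m := R.sum_inn_out m
  right_inv s := by
    refine HomRep.ext (k := k) (S := S) (a := a) (Z := R.center a) fun x => ?_
    change R.out x (∑ y, R.inn y (s y)) = s x
    rw [map_sum, Finset.sum_eq_single x]
    · exact R.out_inn x _
    · intro y _ h
      exact R.out_inn_of_ne h.symm _
    · simp

end Realization

end Comparison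

/-! ### The functor from the Drinfeld center to representations of the tube algebra -/

section Functor

variable (k : Type u') [Field k] [IsAlgClosed k] {ι : Type w} [Fintype ι] {C : Type u}
  [Category.{v} C] [Abelian C] [Linear k C] [MonoidalCategory C] [MonoidalPreadditive C]
  [MonoidalLinear k C] [RigidCategory C] [FusionCategory k C] (S : SimpleSystem ι C)

variable (a : PivotalStructure C)

open scoped ModuleCat

namespace HomRep

instance (Z : Center C) : FiniteDimensional k (HomRep k S a Z) := by
  have := fun x => FusionCategory.finiteDimensional_hom (k := k) (S.obj x) Z.1
  exact inferInstanceAs (FiniteDimensional k (∀ x, S.obj x ⟶ Z.1))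

variable {k S a}

/-- Composition with a morphism of the Drinfeld center, as a map of modules. -/
def map {Z Z' : Center C} (f : Z ⟶ Z') : HomRep k S a Z →ₗ[Tube k S] HomRep k S a Z' where
  toFun s x := s x ≫ f.f
  map_add' s t := by
    ext x
    exact Preadditive.add_comp _ _ _ _ _ _
  map_smul' g s := by
    ext x
    simp only [tube_smul_apply, Preadditive.sum_comp, tubeAct_comp, RingHom.id_apply]
    rfl

lemma algebraMap_tube_smul {Z : Center C} (c : k) (s : HomRep k S a Z) :
    algebraMap k (Tube k S) c • s = c • s := algebraMap_smul (Tube k S) c s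

lemma map_apply {Z Z' : Center C} (f : Z ⟶ Z') (s : HomRep k S a Z) (x : ι) :
    map f s x = s x ≫ f.f := rfl

lemma map_smul_hom {Z Z' : Center C} (c : k) (f : Z ⟶ Z') (s : HomRep k S a Z) :
    map (c • f) s = c • map f s :=
  HomRep.ext fun x => Linear.comp_smul _ _ _ (s x) c f.f

lemma map_injective {Z Z' : Center C} :
    Function.Injective fun f : Z ⟶ Z' => (map f : HomRep k S a Z →ₗ[Tube k S] _) := by
  classical
  intro f g h
  refine Center.ext _ _ (hom_ext_incl (k := k) (S := S) fun x b => ?_)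
  let s : HomRep k S a Z := Pi.single (M := fun x => S.obj x ⟶ Z.1) x ((decomp k S Z.1).incl x b)
  have hs : s x = (decomp k S Z.1).incl x b := Pi.single_eq_same _ _
  have := congrFun (LinearMap.congr_fun h s) x
  simpa only [map_apply, hs] using this

/-- A module map preserves the summands cut out by the idempotents. Semisimplicity makes it
composition with some `f`, and linearity over tubes makes `f` central. -/
lemma map_surjective {Z Z' : Center C} :
    Function.Surjective fun f : Z ⟶ Z' => (map f : HomRep k S a Z →ₗ[Tube k S] _) := by
  classical
  intro φ
  let sg : ∀ x, (S.obj x ⟶ Z.1) →ₗ[k] HomRep k S a Z :=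
    fun x => LinearMap.single k (fun x => S.obj x ⟶ Z.1) x
  have sg_same : ∀ x s, sg x s x = s := fun x s => Pi.single_eq_same (M := fun x => S.obj x ⟶ Z.1) x s
  have sg_ne : ∀ x y s, y ≠ x → sg x s y = 0 := fun x y s h =>
    Pi.single_eq_of_ne (M := fun x => S.obj x ⟶ Z.1) h s
  have idem_smul : ∀ x (s : HomRep k S a Z), Tube.idem k S x • s = sg x (s x) := by
    intro x s
    ext y
    by_cases h : y = x
    · subst h
      rw [idem_smul_apply, sg_same]
    · rw [idem_smul_apply_of_ne h, sg_ne _ _ _ h]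
  let F : ∀ x, (S.obj x ⟶ Z.1) →ₗ[k] (S.obj x ⟶ Z'.1) := fun x =>
    LinearMap.proj (R := k) (φ := fun x => S.obj x ⟶ Z'.1) x ∘ₗ φ.restrictScalars k ∘ₗ sg x
  have hF : ∀ x s, F x s = φ (sg x s) x := fun x s => rfl
  -- Commuting with `id_x` makes `φ` diagonal in the index `x`.
  have hφ : ∀ s x, φ s x = F x (s x) := by
    intro s x
    rw [hF, ← idem_smul, map_smul, idem_smul_apply]
  let f : Z.1 ⟶ Z'.1 := ofFamily k S F
  have hf : ∀ x (s : S.obj x ⟶ Z.1), s ≫ f = F x s := fun x s => comp_ofFamily k S F x s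
  have h1 : ∀ (x y : ι) (W : C) (g : S.obj x ⊗ W ⟶ W ⊗ S.obj y) (s : S.obj y ⟶ Z.1),
      tubeAct a Z g s ≫ f = tubeAct a Z' g (s ≫ f) := by
    intro x y W g s
    have h := congrFun (φ.map_smul (Tube.lift k S x y W g) (sg y s)) x
    rw [hφ, lift_smul_apply, lift_smul_apply, hφ, sg_same] at h
    rw [hf, hf, h]
  -- Decomposing both boundaries extends the commutation from simple to arbitrary ones.
  have h2 : ∀ (X Y W : C) (g : X ⊗ W ⟶ W ⊗ Y) (s : Y ⟶ Z.1),
      tubeAct a Z g s ≫ f = tubeAct a Z' g (s ≫ f) := by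
    intro X Y W g s
    refine hom_ext_incl (k := k) (S := S) fun x b => ?_
    have hZ := (tubeAction a Z).comp_act ((decomp k S X).incl x b) g s
    have hZ' := (tubeAction a Z').comp_act ((decomp k S X).incl x b) g (s ≫ f)
    simp only [tubeAction_act] at hZ hZ'
    rw [← Category.assoc, hZ, hZ', tubeAct_eq_sum k S a Z, tubeAct_eq_sum k S a Z']
    simp only [Preadditive.sum_comp, h1, Category.assoc]
  exact ⟨⟨f, comm_of_tubeAct a f h2⟩, LinearMap.ext fun s => HomRep.ext fun x =>
    (hf x (s x)).trans (hφ s x).symm⟩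

end HomRep

/-- Finite-dimensionality in `FinDimRep` refers to scalars acting through `Tube k S`; these agree
with the pointwise scalars. -/
lemma moduleOfAlgebraModule_homRep (Z : Center C) :
    ModuleCat.moduleOfAlgebraModule (k := k) (ModuleCat.of (Tube k S) (HomRep k S a Z)) =
      (inferInstance : Module k (HomRep k S a Z)) :=
  Module.ext' _ _ fun r s => HomRep.algebraMap_tube_smul r s

/-- The functor `(z, γ) ↦ ⨁_x C(x, z)`. -/
def homRepFunctor : Center C ⥤ FinDimRep k (Tube k S) where
  obj Z := ⟨ModuleCat.of (Tube k S) (HomRep k S a Z), by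
    rw [moduleOfAlgebraModule_homRep]
    infer_instance⟩
  map f := ObjectProperty.homMk (ModuleCat.ofHom (HomRep.map f))
  map_id Z := ObjectProperty.hom_ext _ (ModuleCat.hom_ext (LinearMap.ext fun s =>
    HomRep.ext (k := k) (S := S) (a := a) fun x => Category.comp_id (s x)))
  map_comp f g := ObjectProperty.hom_ext _ (ModuleCat.hom_ext (LinearMap.ext fun s =>
    HomRep.ext (k := k) (S := S) (a := a) fun x => (Category.assoc (s x) f.f g.f).symm))

instance : (homRepFunctor k S a).Additive where
  map_add {_ _ f g} := ObjectProperty.hom_ext _ (ModuleCat.hom_ext (LinearMap.ext fun s =>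
    HomRep.ext (k := k) (S := S) (a := a) fun x => Preadditive.comp_add _ _ _ (s x) f.f g.f))

instance : (homRepFunctor k S a).Linear k where
  map_smul f c := ObjectProperty.hom_ext _ (ModuleCat.hom_ext (LinearMap.ext fun s =>
    (HomRep.map_smul_hom (k := k) (S := S) (a := a) c f s).trans
      (HomRep.algebraMap_tube_smul c _).symm))

instance : (homRepFunctor k S a).Faithful where
  map_injective h := HomRep.map_injective (k := k) (S := S) (a := a)
    (congrArg (fun φ => ModuleCat.Hom.hom (InducedCategory.Hom.hom φ)) h)

instance : (homRepFunctor k S a).Full where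
  map_surjective φ := by
    obtain ⟨f, hf⟩ := HomRep.map_surjective (k := k) (S := S) (a := a) φ.hom.hom
    exact ⟨f, ObjectProperty.hom_ext _ (ModuleCat.hom_ext hf)⟩

instance : (homRepFunctor k S a).EssSurj where
  mem_essImage M := by
    have : FiniteDimensional k M.obj := M.property
    obtain ⟨z, ⟨R⟩⟩ := exists_realization k S M.obj
    exact ⟨R.center a, ⟨ObjectProperty.isoMk _ (R.equivHomRep a).toModuleIso.symm⟩⟩

instance : (homRepFunctor k S a).IsEquivalence where

/-- The identification of the values of the functor. -/
def homRepFunctorEquiv (Z : Center C) :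
    ((homRepFunctor k S a).obj Z).obj ≃ₗ[k] (∀ x : ι, S.obj x ⟶ Z.1) where
  toFun s := s
  invFun s := s
  map_add' _ _ := rfl
  map_smul' r s := HomRep.algebraMap_tube_smul (S := S) (a := a) (Z := Z) r s
  left_inv _ := rfl
  right_inv _ := rfl

end Functor

end TubeAlgebra

end

open TubeAlgebra
open scoped ModuleCat
/-- For a pivotal fusion category `C` with a complete set `S` of pairwise non-isomorphic simple
objects, there is a `k`-linear equivalence `J` from the Drinfeld center of `C` to the category of
finite-dimensional representations of the tube algebra, sending `(z, γ)` to `⨁_x C(x, z)` (and a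
morphism to composition with it), where `g ∈ C(x ⊗ w, w ⊗ y)` acts on `C(y, z)` by `tubeAct` and
on the other summands by zero. -/
theorem theoremB2
    (k : Type u') [Field k] [IsAlgClosed k] [CharZero k]
    (C : Type u) [Category.{v} C] [Abelian C] [Linear k C] [MonoidalCategory C]
    [MonoidalPreadditive C] [MonoidalLinear k C] [RigidCategory C] [FusionCategory k C]
    (a : PivotalStructure C)
    {ι : Type w} [Fintype ι] (S : SimpleSystem ι C) :
    ∃ J : Center C ≌ FinDimRep k (Tube k S),
      J.functor.Additive ∧ J.functor.Linear k ∧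
      ∃ e : ∀ Z : Center C, (J.functor.obj Z).obj ≃ₗ[k] (∀ x : ι, S.obj x ⟶ Z.1),
        (∀ (Z Z' : Center C) (f : Z ⟶ Z') (m : (J.functor.obj Z).obj) (x : ι),
          e Z' ((J.functor.map f).hom m) x = e Z m x ≫ f.f) ∧
        (∀ (Z : Center C) (g : Tube k S) (m : (J.functor.obj Z).obj) (x : ι),
          e Z (g • m) x = ∑ w, ∑ y, tubeAct a Z (g w x y) (e Z m y)) := by
  -- Both formulas hold definitionally, since `homRepFunctorEquiv` leaves the underlying families
  -- unchanged.
  exact ⟨(homRepFunctor k S a).asEquivalence, inferInstanceAs (homRepFunctor k S a).Additive,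
    inferInstanceAs ((homRepFunctor k S a).Linear k), homRepFunctorEquiv k S a,
    fun _ _ _ _ _ => rfl, fun _ _ _ _ => rfl⟩
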